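/- Let $P_+(X)$ be the family of nonempty subsets of a finite set $X$ (the alternatives). A choice function on $X$ is a map $c:P_+(X)\to X$ with $c(S)\in S$ for all $S$. It is rational if, for some linear ordering of $X$, $c(S)$ is the highest element of $S$ for every $S$. A social choice function for $n$ individuals is a map $F$ that assigns a choice function $c=F(c_1,\dots,c_n)$ on $X$ to every profile $(c_1,\dots,c_n)$ of rational choice functions on $X$ (unrestricted domain). Consider the following conditions on $F$. - (IRA) For each $S$, $c(S)$ depends only on $(c_1(S),\dots,c_n(S))$. - (Pareto) $c(S)\in\{c_1(S),\dots,c_n(S)\}$ for every profile and every $S$. - (Neutrality) $F(\sigma c_1,\dots,\sigma c_n)=\sigma F(c_1,\dots,c_n)$ for every permutation $\sigma$ of $X$, where $(\sigma c)(S)=\sigma(c(\sigma^{-1}S))$. - (Weak anonymity) There is a transitive group $G$ of permutations of $\{1,\dots,n\}$ with $F(c_{g(1)},\dots,c_{g(n)})=F(c_1,\dots,c_n)$ for all $g\in G$ and all profiles. - (Monotonicity) If $c(S)=s$ and $c_i(S)\ne s$, and the choice function of individual $i$ alone is replaced by a rational choice function that chooses $s$ from $S$, then the social choice from $S$ is still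 $s$. Theorem. There is a function $N(\delta,m)$ with the following property. Let $X$ be a set of $m$ alternatives and $c_0$ a choice function on $X$. Then there is a probability distribution $\nu=\nu(c_0)$ on the linear orderings of $X$ such that for every $\delta<1$, every $n>N(\delta,m)$ and every social choice function $F$ for $n$ individuals that satisfies (IRA), (Pareto), (Neutrality), (Weak anonymity) and (Monotonicity): if the $n$ individuals draw orderings independently according to $\nu$ and $c_i(S)$ is the highest ranked alternative of $S$ in the ordering of individual $i$, then with probability at least $\delta$ the choice function $c=F(c_1,\dots,c_n)$ satisfies $c(S)=c_0(S)$ simultaneously for all $S\in P_+(X)$. -/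

import Mathlib

open MeasureTheory

noncomputable section

/-- The family `P₊(X)` of nonempty (finite) subsets of `X`. -/
abbrev NonemptySubset (X : Type*) := {S : Finset X // S.Nonempty}

/-- The image of a nonempty subset under a permutation of the alternatives. -/
def NonemptySubset.perm {X : Type*} (σ : Equiv.Perm X) (S : NonemptySubset X) :
    NonemptySubset X :=
  ⟨S.1.map σ.toEmbedding, S.2.map⟩

/-- A choice function assigns to each nonempty set `S` of alternatives an element of `S`. -/
@[ext]
structure ChoiceFunction (X : Type*) where
  choice : NonemptySubset X → X
  choice_mem : ∀ S, choice S ∈ S.1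

/-- A choice function is rational if, for some linear ordering of the alternatives, `c(S)` is the
maximal element of `S` for every nonempty `S`. -/
def ChoiceFunction.IsRational {X : Type*} (c : ChoiceFunction X) : Prop :=
  ∃ L : LinearOrder X, ∀ S : NonemptySubset X, ∀ x ∈ S.1, L.le x (c.choice S)

/-- Relabelling the alternatives of a choice function: `(σ c)(S) = σ (c (σ⁻¹ S))`. -/
def ChoiceFunction.perm {X : Type*} (σ : Equiv.Perm X) (c : ChoiceFunction X) :
    ChoiceFunction X where
  choice S := σ (c.choice (S.perm σ.symm))
  choice_mem S := by
    have h := c.choice_mem (S.perm σ.symm)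
    obtain ⟨y, hy, hyx⟩ := Finset.mem_map.mp h
    rw [← hyx]
    simpa using hy

theorem ChoiceFunction.IsRational.perm {X : Type*} {c : ChoiceFunction X} (hc : c.IsRational)
    (σ : Equiv.Perm X) : (c.perm σ).IsRational := by
  obtain ⟨L, hL⟩ := hc
  refine ⟨LinearOrder.lift' σ.symm σ.symm.injective, fun S x hx => ?_⟩
  change L.le (σ.symm x) (σ.symm (σ (c.choice (S.perm σ.symm))))
  rw [Equiv.symm_apply_apply]
  exact hL (S.perm σ.symm) _ (Finset.mem_map_of_mem σ.symm.toEmbedding hx)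

/-- The rational choice functions on `X`: the possible choice functions of an individual. -/
abbrev RationalChoiceFunction (X : Type*) := {c : ChoiceFunction X // c.IsRational}

/-- Relabelling the alternatives of a rational choice function. -/
def RationalChoiceFunction.perm {X : Type*} (σ : Equiv.Perm X) (c : RationalChoiceFunction X) :
    RationalChoiceFunction X :=
  ⟨c.1.perm σ, c.2.perm σ⟩

/-- The choice function of an individual who ranks the alternatives by `L`: from each nonempty
set `S` the highest ranked alternative is chosen. -/
def topChoice {X : Type*} (L : LinearOrder X) : RationalChoiceFunction X :=
  ⟨⟨fun S => @Finset.max' X L S.1 S.2, fun S => @Finset.max'_mem X L S.1 S.2⟩,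
    L, fun S x hx => @Finset.le_max' X L S.1 x hx⟩

/-- A social choice function for `n` individuals. It is defined for every profile of rational
choice functions of the individuals (unrestricted domain). -/
abbrev SocialChoiceFunction (n : ℕ) (X : Type*) :=
  (Fin n → RationalChoiceFunction X) → ChoiceFunction X

namespace SocialChoiceFunction

variable {n : ℕ} {X : Type*} (F : SocialChoiceFunction n X)

/-- Independence of rejected alternatives: `c(S)` is a function of `(c₁(S), …, cₙ(S))`. -/
def IndependentOfRejected : Prop :=
  ∀ S : NonemptySubset X, ∀ P Q : Fin n → RationalChoiceFunction X,
    (∀ i, (P i).1.choice S = (Q i).1.choice S) → (F P).choice S = (F Q).choice S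

/-- Pareto: `c(S)` is one of `c₁(S), …, cₙ(S)`. -/
def Pareto : Prop :=
  ∀ S : NonemptySubset X, ∀ P : Fin n → RationalChoiceFunction X,
    ∃ i, (F P).choice S = (P i).1.choice S

/-- Neutrality: invariance under permutations of the alternatives. -/
def Neutral : Prop :=
  ∀ σ : Equiv.Perm X, ∀ P : Fin n → RationalChoiceFunction X,
    F (fun i => (P i).perm σ) = (F P).perm σ

/-- Weak anonymity: invariance under a transitive group of permutations of the individuals. -/
def WeaklyAnonymous : Prop :=
  ∃ G : Subgroup (Equiv.Perm (Fin n)), MulAction.IsPretransitive G (Fin n) ∧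
    ∀ g ∈ G, ∀ P : Fin n → RationalChoiceFunction X, F (fun i => P (g i)) = F P

/-- Monotonicity: if `c(S) = s` and `cᵢ(S) ≠ s`, then changing the choice of individual `i`
from `S` to `s` (all others unchanged) does not change `c(S)`. -/
def Monotonic : Prop :=
  ∀ S : NonemptySubset X, ∀ P Q : Fin n → RationalChoiceFunction X, ∀ i : Fin n,
    (P i).1.choice S ≠ (F P).choice S → (Q i).1.choice S = (F P).choice S →
    (∀ j, j ≠ i → Q j = P j) → (F Q).choice S = (F P).choice S

end SocialChoiceFunction

/-- Every set of orderings is an event. -/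
instance linearOrderMeasurableSpace (X : Type*) : MeasurableSpace (LinearOrder X) := ⊤

/-- The law of `n` independent random orderings, each distributed according to `ν`. -/
def iidOrderings {X : Type*} (ν : PMF (LinearOrder X)) (n : ℕ) :
    Measure (Fin n → LinearOrder X) :=
  Measure.pi fun _ => ν.toMeasure

end

/-!
For each set `S` of alternatives, neutrality forces the outcome to be uniform on `S` when the
individual orderings are uniform. The distribution `ν` is a small perturbation of the uniform one
that, for every `S` at once, raises the probability that `c₀ S` is the top choice from `S` and
lowers that of all other elements of `S` equally. A monotone, transitively symmetric event has a
sharp threshold, so for many individuals this perturbation makes `c₀ S` the outcome with probability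
close to one; a union bound over the sets `S` finishes the proof.

*The perturbation* (`PermOrder.tilt`, `PermOrder.sum_tilt_mul_topInd`). Place `S` below all other
alternatives and compare the orderings with `s` on top of `S` to all of them: this signed weight
moves the top choice towards `s` exactly for the sets `T` with `s ∈ T ⊆ S`
(`PermOrder.sum_raise_mul_topInd`). Möbius inversion over supersets then combines these weights to
any prescribed targets. Orderings are encoded by bijections with `Fin m`, so that probabilities are
finite weighted sums.

*The sharp threshold* (`FiniteProduct.exists_sharp_threshold`). Along the segment from the uniform to
the perturbed weights, the Margulis–Russo formula and monotonicity bound the derivative of the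
probability below by a multiple of the total influence. By symmetry all coordinates contribute
equally to the derivative; if it were at most `1` at some point, every influence would be `O(1/n)`.
This contradicts `FiniteProduct.mul_log_le_of_influence_le` for large `n`, as long as the probability
is bounded away from `0` and `1`. That inequality of Kahn–Kalai–Linial type follows the entropy method
of Falik and Samorodnitsky: the martingale differences of the indicator have small `L¹` norm, hence
large entropy (`FiniteProduct.le_entropy_sq`), while a logarithmic Sobolev inequality
(`FiniteProduct.entropy_sq_le`) bounds their entropies by the total influence. The constants depend
only on the number of alternatives, because the smallest weight of an ordering does.
-/

/-! ### Expectation and coordinate averages on a finite product space -/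

namespace FiniteProduct

section Operators

variable {ι Ω : Type*} [Fintype ι] [DecidableEq ι] [Fintype Ω]

/-- The expectation of a function of independent coordinates, each distributed with weights `w`. -/
noncomputable def expect (w : Ω → ℝ) : ((ι → Ω) → ℝ) →ₗ[ℝ] ℝ where
  toFun f := ∑ x, (∏ i, w (x i)) * f x
  map_add' f g := by simp [mul_add, Finset.sum_add_distrib]
  map_smul' c f := by simp [Finset.mul_sum, mul_left_comm]

/-- The conditional expectation that averages out the coordinate `i`. -/
noncomputable def avg (w : Ω → ℝ) (i : ι) : Module.End ℝ ((ι → Ω) → ℝ) where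
  toFun f x := ∑ a, w a * f (Function.update x i a)
  map_add' f g := by ext x; simp [mul_add, Finset.sum_add_distrib]
  map_smul' c f := by ext x; simp [Finset.mul_sum, mul_left_comm]

theorem expect_apply (w : Ω → ℝ) (f : (ι → Ω) → ℝ) :
    expect w f = ∑ x, (∏ i, w (x i)) * f x := rfl

omit [Fintype ι] in
theorem avg_apply (w : Ω → ℝ) (i : ι) (f : (ι → Ω) → ℝ) (x : ι → Ω) :
    avg w i f x = ∑ a, w a * f (Function.update x i a) := rfl

omit [Fintype Ω] in
theorem prod_update_erase (w : Ω → ℝ) (i : ι) (x : ι → Ω) (a : Ω) :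
    ∏ j ∈ Finset.univ.erase i, w (Function.update x i a j) =
      ∏ j ∈ Finset.univ.erase i, w (x j) :=
  Finset.prod_congr rfl fun j hj => by rw [Function.update_of_ne (Finset.ne_of_mem_erase hj)]

/-- Exchanging the value of coordinate `i` with an independent copy `a` of it is a bijection. -/
theorem sum_sum_swap (i : ι) (H : (ι → Ω) → Ω → ℝ) :
    ∑ x, ∑ a, H x a = ∑ x : ι → Ω, ∑ a, H (Function.update x i a) (x i) := by
  rw [← Fintype.sum_prod_type', ← Fintype.sum_prod_type']
  have hinv : Function.Involutive
      (fun p : (ι → Ω) × Ω => (Function.update p.1 i p.2, p.1 i)) := by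
    rintro ⟨x, a⟩
    simp
  exact (Equiv.sum_comp hinv.toPerm (fun p : (ι → Ω) × Ω => H p.1 p.2)).symm

variable {w : Ω → ℝ}

/-- Replacing the weight of one coordinate by an arbitrary `v` amounts to taking the expectation
of the `v`-weighted sum over that coordinate. -/
theorem expect_sum_update (hs : ∑ a, w a = 1) (v : Ω → ℝ) (i : ι) (f : (ι → Ω) → ℝ) :
    expect w (fun x => ∑ a, v a * f (Function.update x i a)) =
      ∑ x : ι → Ω, (∏ j ∈ Finset.univ.erase i, w (x j)) * v (x i) * f x := by
  have h := sum_sum_swap i (fun (x : ι → Ω) a =>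
    w a * ((∏ j ∈ Finset.univ.erase i, w (x j)) * v (x i) * f x))
  simp only [← Finset.sum_mul, hs, one_mul, prod_update_erase, Function.update_self] at h
  rw [h, expect_apply]
  refine Finset.sum_congr rfl fun x _ => ?_
  rw [Finset.mul_sum, ← Finset.mul_prod_erase _ _ (Finset.mem_univ i)]
  exact Finset.sum_congr rfl fun a _ => by ring

theorem expect_avg (hs : ∑ a, w a = 1) (i : ι) (f : (ι → Ω) → ℝ) :
    expect w (avg w i f) = expect w f := by
  refine (expect_sum_update hs w i f).trans ?_
  rw [expect_apply]
  refine Finset.sum_congr rfl fun x _ => ?_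
  rw [← Finset.mul_prod_erase _ _ (Finset.mem_univ i), mul_comm (w (x i))]

theorem expect_const (hs : ∑ a, w a = 1) (c : ℝ) :
    expect w (fun _ : ι → Ω => c) = c := by
  rw [expect_apply, ← Finset.sum_mul, ← Fintype.prod_sum]
  simp [hs]

theorem expect_mono (hw : ∀ a, 0 < w a) {f g : (ι → Ω) → ℝ} (h : ∀ x, f x ≤ g x) :
    expect w f ≤ expect w g :=
  Finset.sum_le_sum fun x _ =>
    mul_le_mul_of_nonneg_left (h x) (Finset.prod_nonneg fun _ _ => (hw _).le)

theorem expect_nonneg (hw : ∀ a, 0 < w a) {f : (ι → Ω) → ℝ} (h : ∀ x, 0 ≤ f x) :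
    0 ≤ expect w f :=
  Finset.sum_nonneg fun x _ => mul_nonneg (Finset.prod_nonneg fun _ _ => (hw _).le) (h x)

theorem eq_zero_of_expect_eq_zero (hw : ∀ a, 0 < w a) {f : (ι → Ω) → ℝ} (h : ∀ x, 0 ≤ f x)
    (h0 : expect w f = 0) (x : ι → Ω) : f x = 0 := by
  have hp : 0 < ∏ i, w (x i) := Finset.prod_pos fun _ _ => hw _
  have := (Finset.sum_eq_zero_iff_of_nonneg fun x _ =>
    mul_nonneg (Finset.prod_nonneg fun _ _ => (hw _).le) (h x)).1 h0 x (Finset.mem_univ x)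
  exact (mul_eq_zero.1 this).resolve_left hp.ne'

omit [Fintype ι] in
theorem avg_update (i : ι) (f : (ι → Ω) → ℝ) (x : ι → Ω) (a : Ω) :
    avg w i f (Function.update x i a) = avg w i f x := by
  simp [avg_apply]

omit [Fintype ι] in
/-- The average over coordinate `i` pulls out factors that do not depend on that coordinate. -/
theorem avg_mul_avg (i : ι) (f g : (ι → Ω) → ℝ) :
    avg w i (f * avg w i g) = avg w i f * avg w i g := by
  ext x
  rw [Pi.mul_apply, avg_apply, avg_apply w i f, Finset.sum_mul]
  exact Finset.sum_congr rfl fun a _ => by rw [Pi.mul_apply, avg_update, mul_assoc]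

omit [Fintype ι] in
theorem avg_idem (hs : ∑ a, w a = 1) (i : ι) (f : (ι → Ω) → ℝ) :
    avg w i (avg w i f) = avg w i f := by
  ext x
  rw [avg_apply]
  simp only [avg_update, ← Finset.sum_mul, hs, one_mul]

omit [Fintype ι] in
theorem avg_commute (i j : ι) : Commute (avg w i) (avg w j) := by
  rcases eq_or_ne i j with rfl | hij
  · exact Commute.refl _
  · ext1 f
    ext x
    simp only [Module.End.mul_apply, avg_apply, Finset.mul_sum]
    rw [Finset.sum_comm]
    refine Finset.sum_congr rfl fun a _ => Finset.sum_congr rfl fun b _ => ?_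
    rw [Function.update_comm hij.symm, mul_left_comm]

omit [Fintype ι] in
theorem abs_avg_le (hw : ∀ a, 0 < w a) (i : ι) (f : (ι → Ω) → ℝ) (x : ι → Ω) :
    |avg w i f x| ≤ avg w i |f| x := by
  simp only [avg_apply]
  refine (Finset.abs_sum_le_sum_abs _ _).trans_eq (Finset.sum_congr rfl fun a _ => ?_)
  rw [abs_mul, abs_of_pos (hw a), Pi.abs_apply]

theorem expect_avg_sq (hs : ∑ a, w a = 1) (i : ι) (f : (ι → Ω) → ℝ) :
    expect w ((f - avg w i f) ^ 2) = expect w (f ^ 2) - expect w (avg w i f ^ 2) := by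
  have h1 : expect w (f * avg w i f) = expect w (avg w i f ^ 2) := by
    rw [← expect_avg hs i, avg_mul_avg, sq]
  have h2 : (f - avg w i f) ^ 2 = f ^ 2 - (2 : ℝ) • (f * avg w i f) + avg w i f ^ 2 := by
    ext x
    simp
    ring
  rw [h2, map_add, map_sub, map_smul, h1, smul_eq_mul]
  ring

/-! ### Successive averaging -/

/-- The operator that averages out the coordinates `c 0, …, c (k - 1)`. -/
noncomputable def partialAvg (w : Ω → ℝ) (c : ℕ → ι) : ℕ → Module.End ℝ ((ι → Ω) → ℝ)
  | 0 => 1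
  | k + 1 => avg w (c k) * partialAvg w c k

omit [Fintype ι] in
theorem partialAvg_succ (c : ℕ → ι) (k : ℕ) (f : (ι → Ω) → ℝ) :
    partialAvg w c (k + 1) f = avg w (c k) (partialAvg w c k f) := rfl

omit [Fintype ι] in
theorem avg_commute_partialAvg (c : ℕ → ι) (k : ℕ) (i : ι) :
    Commute (avg w i) (partialAvg w c k) := by
  induction k with
  | zero => exact Commute.one_right _
  | succ k ih => exact (avg_commute i (c k)).mul_right ih

omit [Fintype ι] in
theorem avg_partialAvg (c : ℕ → ι) (k : ℕ) (i : ι) (f : (ι → Ω) → ℝ) :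
    avg w i (partialAvg w c k f) = partialAvg w c k (avg w i f) :=
  LinearMap.congr_fun (avg_commute_partialAvg c k i) f

theorem expect_partialAvg (hs : ∑ a, w a = 1) (c : ℕ → ι) (k : ℕ) (f : (ι → Ω) → ℝ) :
    expect w (partialAvg w c k f) = expect w f := by
  induction k with
  | zero => rfl
  | succ k ih => rw [partialAvg_succ, expect_avg hs, ih]

theorem expect_abs_partialAvg_le (hw : ∀ a, 0 < w a) (hs : ∑ a, w a = 1) (c : ℕ → ι) (k : ℕ)
    (f : (ι → Ω) → ℝ) : expect w |partialAvg w c k f| ≤ expect w |f| := by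
  induction k with
  | zero => rfl
  | succ k ih =>
    refine le_trans ?_ ih
    rw [← expect_avg hs (c k) |partialAvg w c k f|]
    exact expect_mono hw fun x => abs_avg_le hw _ _ x

/-- The martingale differences of successive averaging are orthogonal. -/
theorem sum_expect_diff_sq (hs : ∑ a, w a = 1) (c : ℕ → ι) (k : ℕ) (f : (ι → Ω) → ℝ) :
    ∑ l ∈ Finset.range k, expect w ((partialAvg w c l f - partialAvg w c (l + 1) f) ^ 2) =
      expect w (f ^ 2) - expect w (partialAvg w c k f ^ 2) := by
  induction k with
  | zero => simp [partialAvg]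
  | succ k ih =>
    rw [Finset.sum_range_succ, ih, partialAvg_succ, expect_avg_sq hs]
    ring

theorem partialAvg_update (c : ℕ → ι) (k : ℕ) (f : (ι → Ω) → ℝ) (hs : ∑ a, w a = 1)
    {l : ℕ} (hl : l < k) (x : ι → Ω) (a : Ω) :
    partialAvg w c k f (Function.update x (c l) a) = partialAvg w c k f x := by
  have h : avg w (c l) (partialAvg w c k f) = partialAvg w c k f := by
    induction k with
    | zero => omega
    | succ k ih =>
      rcases Nat.lt_succ_iff_lt_or_eq.1 hl with h | rfl
      · rw [partialAvg_succ, ← Module.End.mul_apply (avg w (c l)),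
          (avg_commute (c l) (c k)).eq, Module.End.mul_apply, ih h]
      · rw [partialAvg_succ, avg_idem hs]
  rw [← h, avg_update]

omit [Fintype Ω] in
theorem eq_of_forall_update_eq {g : (ι → Ω) → ℝ}
    (h : ∀ x i a, g (Function.update x i a) = g x) (x y : ι → Ω) : g x = g y := by
  have key : ∀ s : Finset ι, g (s.piecewise x y) = g y := by
    intro s
    induction s using Finset.induction_on with
    | empty => simp
    | insert i s _ ih => rw [Finset.piecewise_insert, h, ih]
  simpa using key Finset.univ

/-- Once every coordinate has been averaged out, the constant expectation remains. -/
theorem partialAvg_eq_expect (hs : ∑ a, w a = 1) (c : ℕ → ι) (k : ℕ)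
    (hc : ∀ i, ∃ l < k, c l = i) (f : (ι → Ω) → ℝ) :
    partialAvg w c k f = fun _ => expect w f := by
  ext x
  have hconst : partialAvg w c k f = fun _ => partialAvg w c k f x := by
    ext y
    refine eq_of_forall_update_eq (fun z i a => ?_) y x
    obtain ⟨l, hl, rfl⟩ := hc i
    exact partialAvg_update c k f hs hl z a
  rw [← expect_partialAvg hs c k f, hconst, expect_const hs]

omit [Fintype ι] in
theorem avg_nonneg (hw : ∀ a, 0 < w a) (i : ι) {f : (ι → Ω) → ℝ} (hf : ∀ x, 0 ≤ f x)
    (x : ι → Ω) : 0 ≤ avg w i f x :=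
  Finset.sum_nonneg fun a _ => mul_nonneg (hw a).le (hf _)

omit [Fintype ι] in
theorem partialAvg_nonneg (hw : ∀ a, 0 < w a) (c : ℕ → ι) (k : ℕ) {f : (ι → Ω) → ℝ}
    (hf : ∀ x, 0 ≤ f x) (x : ι → Ω) : 0 ≤ partialAvg w c k f x := by
  induction k generalizing x with
  | zero => exact hf x
  | succ k ih => exact avg_nonneg hw _ ih x

omit [Fintype ι] in
theorem eq_zero_of_partialAvg_eq_zero (hw : ∀ a, 0 < w a) (c : ℕ → ι) (k : ℕ)
    {f : (ι → Ω) → ℝ} (hf : ∀ x, 0 ≤ f x) (x : ι → Ω) (h : partialAvg w c k f x = 0) :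
    f x = 0 := by
  induction k generalizing x with
  | zero => exact h
  | succ k ih =>
    refine ih x ?_
    have := (Finset.sum_eq_zero_iff_of_nonneg fun a _ =>
      mul_nonneg (hw a).le (partialAvg_nonneg hw c k hf _)).1 h (x (c k)) (Finset.mem_univ _)
    simpa [(hw _).ne'] using this

end Operators

/-! ### Entropy and the logarithmic Sobolev inequality -/

section Entropy

variable {Ω : Type*} [Fintype Ω] {w : Ω → ℝ}

/-- The variational (Gibbs) bound for the entropy of a function of one coordinate. -/
theorem sum_mul_log_le_entropy (hw : ∀ a, 0 < w a) {h b : Ω → ℝ} (hh : ∀ a, 0 ≤ h a)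
    (hb : ∀ a, 0 ≤ b a) (hbh : ∀ a, b a = 0 → h a = 0) :
    ∑ a, w a * (h a * (Real.log (b a) - Real.log (∑ a, w a * b a))) ≤
      ∑ a, w a * (h a * Real.log (h a)) -
        (∑ a, w a * h a) * Real.log (∑ a, w a * h a) := by
  set B := ∑ a, w a * b a with hB
  set M := ∑ a, w a * h a with hM
  have hM0 : 0 ≤ M := Finset.sum_nonneg fun a _ => mul_nonneg (hw a).le (hh a)
  have hB0 : 0 ≤ B := Finset.sum_nonneg fun a _ => mul_nonneg (hw a).le (hb a)
  have key : ∀ a, w a * (h a * (Real.log (b a) - Real.log B)) ≤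
      w a * (h a * Real.log (h a)) - w a * h a * Real.log M +
        (w a * b a * (M / B) - w a * h a) := by
    intro a
    rcases (hh a).eq_or_lt with h0 | hpos
    · rw [← h0]
      simpa using mul_nonneg (mul_nonneg (hw a).le (hb a)) (div_nonneg hM0 hB0)
    · have hbpos : 0 < b a := (hb a).lt_of_ne fun h => hpos.ne' (hbh a h.symm)
      have hBpos : 0 < B := (mul_pos (hw a) hbpos).trans_le
        (Finset.single_le_sum (f := fun a => w a * b a)
          (fun a _ => mul_nonneg (hw a).le (hb a)) (Finset.mem_univ a))
      have hMpos : 0 < M := (mul_pos (hw a) hpos).trans_le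
        (Finset.single_le_sum (f := fun a => w a * h a)
          (fun a _ => mul_nonneg (hw a).le (hh a)) (Finset.mem_univ a))
      have hl := Real.log_le_sub_one_of_pos
        (show 0 < b a * M / (B * h a) by positivity)
      rw [Real.log_div (by positivity) (by positivity), Real.log_mul hbpos.ne' hMpos.ne',
        Real.log_mul hBpos.ne' hpos.ne'] at hl
      have h2 := mul_le_mul_of_nonneg_left hl (mul_pos (hw a) hpos).le
      have h3 : w a * h a * (b a * M / (B * h a) - 1) = w a * b a * (M / B) - w a * h a := by
        field_simp
      rw [h3] at h2
      linarith
  refine (Finset.sum_le_sum fun a _ => key a).trans ?_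
  rw [Finset.sum_add_distrib, Finset.sum_sub_distrib, Finset.sum_sub_distrib, ← Finset.sum_mul,
    ← Finset.sum_mul, ← hM, ← hB]
  have : B * (M / B) ≤ M := by
    rcases eq_or_ne B 0 with h | h
    · rw [h]; simpa using hM0
    · rw [mul_div_cancel₀ _ h]
  linarith

/-- A logarithmic Sobolev inequality on a finite probability space whose weights are at
least `lam`. -/
theorem entropy_sq_le_variance {lam : ℝ} (hlam : 0 < lam) (hw : ∀ a, lam ≤ w a)
    (hs : ∑ a, w a = 1) (g : Ω → ℝ) :
    ∑ a, w a * (g a ^ 2 * Real.log (g a ^ 2)) -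
        (∑ a, w a * g a ^ 2) * Real.log (∑ a, w a * g a ^ 2) ≤
      4 / lam * ∑ a, w a * (g a - ∑ a, w a * g a) ^ 2 := by
  have hw0 : ∀ a, 0 < w a := fun a => hlam.trans_le (hw a)
  set M := ∑ a, w a * g a ^ 2 with hM
  set m := ∑ a, w a * g a with hm
  have hnn : ∀ a, 0 ≤ w a * g a ^ 2 := fun a => mul_nonneg (hw0 a).le (sq_nonneg _)
  have hM0 : 0 ≤ M := Finset.sum_nonneg fun a _ => hnn a
  have hVar : 0 ≤ ∑ a, w a * (g a - m) ^ 2 :=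
    Finset.sum_nonneg fun a _ => mul_nonneg (hw0 a).le (sq_nonneg _)
  rcases hM0.eq_or_lt with h0 | hMpos
  · have hz : ∀ a, g a ^ 2 = 0 := fun a => by
      have := (Finset.sum_eq_zero_iff_of_nonneg fun a _ => hnn a).1 h0.symm a (Finset.mem_univ a)
      exact (mul_eq_zero.1 this).resolve_left (hw0 a).ne'
    rw [← h0]
    simp only [hz, Real.log_zero, mul_zero, Finset.sum_const_zero, sub_zero]
    positivity
  -- Pointwise, `log t ≤ t - 1` bounds the entropy of `g ^ 2` by its relative variance.
  have h1 : ∑ a, w a * (g a ^ 2 * Real.log (g a ^ 2)) - M * Real.log M ≤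
      (∑ a, w a * (g a ^ 2 - m ^ 2) ^ 2) / M := by
    have hpt : ∀ a, w a * (g a ^ 2 * Real.log (g a ^ 2)) ≤
        w a * g a ^ 2 * Real.log M + (w a * (g a ^ 2) ^ 2 / M - w a * g a ^ 2) := by
      intro a
      rcases (sq_nonneg (g a)).eq_or_lt with hz | hpos
      · rw [← hz]; simp
      · have hl := Real.log_le_sub_one_of_pos (div_pos hpos hMpos)
        rw [Real.log_div hpos.ne' hMpos.ne'] at hl
        have := mul_le_mul_of_nonneg_left hl (hnn a)
        have h3 : w a * g a ^ 2 * (g a ^ 2 / M - 1) =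
            w a * (g a ^ 2) ^ 2 / M - w a * g a ^ 2 := by ring
        linarith
    have hsum := Finset.sum_le_sum fun a (_ : a ∈ Finset.univ) => hpt a
    rw [Finset.sum_add_distrib, Finset.sum_sub_distrib, ← Finset.sum_mul, ← hM,
      ← Finset.sum_div] at hsum
    have hexp : ∑ a, w a * (g a ^ 2 - m ^ 2) ^ 2 =
        ∑ a, w a * (g a ^ 2) ^ 2 - 2 * m ^ 2 * M + m ^ 4 := by
      have : ∀ a, w a * (g a ^ 2 - m ^ 2) ^ 2 =
          w a * (g a ^ 2) ^ 2 - 2 * m ^ 2 * (w a * g a ^ 2) + w a * m ^ 4 := fun a => by ring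
      simp only [this]
      rw [Finset.sum_add_distrib, Finset.sum_sub_distrib, ← Finset.mul_sum, ← Finset.sum_mul,
        hs, one_mul]
    have h4 : (∑ a, w a * (g a ^ 2) ^ 2) / M - M ≤
        (∑ a, w a * (g a ^ 2 - m ^ 2) ^ 2) / M := by
      rw [hexp, le_div_iff₀ hMpos, sub_mul, div_mul_cancel₀ _ hMpos.ne']
      nlinarith [sq_nonneg (M - m ^ 2)]
    linarith
  refine h1.trans ?_
  rw [div_le_iff₀ hMpos, mul_assoc, Finset.sum_mul, Finset.mul_sum]
  have hmM : m ^ 2 ≤ M := by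
    have : 0 ≤ ∑ a, w a * (g a - m) ^ 2 := hVar
    have h5 : ∑ a, w a * (g a - m) ^ 2 = M - m ^ 2 := by
      have : ∀ a, w a * (g a - m) ^ 2 =
          w a * g a ^ 2 - 2 * m * (w a * g a) + w a * m ^ 2 := fun a => by ring
      simp only [this]
      rw [Finset.sum_add_distrib, Finset.sum_sub_distrib, ← Finset.mul_sum, ← Finset.sum_mul,
        hs, ← hm, ← hM]
      ring
    linarith
  refine Finset.sum_le_sum fun a _ => ?_
  have hga : g a ^ 2 ≤ M / lam := by
    rw [le_div_iff₀ hlam]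
    calc g a ^ 2 * lam ≤ w a * g a ^ 2 := by nlinarith [hw a, sq_nonneg (g a)]
      _ ≤ M := Finset.single_le_sum (f := fun a => w a * g a ^ 2)
          (fun a _ => hnn a) (Finset.mem_univ a)
  have hlam1 : lam ≤ 1 := (hw a).trans
    (hs ▸ Finset.single_le_sum (fun a _ => (hw0 a).le) (Finset.mem_univ a))
  have hM' : M ≤ M / lam := by
    rw [le_div_iff₀ hlam]
    nlinarith
  have hsum : (g a + m) ^ 2 ≤ 4 / lam * M := by
    have : 4 / lam * M = 4 * (M / lam) := by ring
    nlinarith [sq_nonneg (g a - m)]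
  calc w a * (g a ^ 2 - m ^ 2) ^ 2 = w a * (g a - m) ^ 2 * (g a + m) ^ 2 := by ring
    _ ≤ w a * (g a - m) ^ 2 * (4 / lam * M) :=
        mul_le_mul_of_nonneg_left hsum (mul_nonneg (hw0 a).le (sq_nonneg _))
    _ = 4 / lam * (w a * (g a - m) ^ 2 * M) := by ring

variable {ι : Type*} [Fintype ι] [DecidableEq ι]

/-- The entropy functional `E[h log h] - E[h] log E[h]`; at zeros of `h` the conventions
`log 0 = 0` and `0 * log 0 = 0` agree with the limiting values. -/
noncomputable def entropy (w : Ω → ℝ) (h : (ι → Ω) → ℝ) : ℝ :=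
  expect w (fun x => h x * Real.log (h x)) - expect w h * Real.log (expect w h)

/-- The logarithmic Sobolev inequality on the product space. The entropy telescopes along the
successive averages of `g ^ 2`, each increment is at most an averaged one-coordinate entropy by the
variational bound, and the one-coordinate inequality applies to that. -/
theorem entropy_sq_le {lam : ℝ} (hlam : 0 < lam) (hw : ∀ a, lam ≤ w a)
    (hs : ∑ a, w a = 1) (c : ℕ → ι) (n : ℕ) (hc : ∀ i, ∃ l < n, c l = i) (g : (ι → Ω) → ℝ) :
    entropy w (g ^ 2) ≤
      4 / lam * ∑ k ∈ Finset.range n, expect w ((g - avg w (c k) g) ^ 2) := by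
  have hw0 : ∀ a, 0 < w a := fun a => hlam.trans_le (hw a)
  set h : (ι → Ω) → ℝ := g ^ 2 with hh
  have hnn : ∀ x, 0 ≤ h x := fun x => sq_nonneg (g x)
  have htel : entropy w h = ∑ k ∈ Finset.range n, expect w (fun x => h x *
      (Real.log (partialAvg w c k h x) - Real.log (partialAvg w c (k + 1) h x))) := by
    have h1 : (fun x => h x * Real.log (h x)) - Real.log (expect w h) • h =
        ∑ k ∈ Finset.range n, (fun x => h x *
          (Real.log (partialAvg w c k h x) - Real.log (partialAvg w c (k + 1) h x))) := by
      ext x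
      rw [Finset.sum_apply, ← Finset.mul_sum, Finset.sum_range_sub',
        partialAvg_eq_expect hs c n hc]
      simp only [Pi.sub_apply, Pi.smul_apply, smul_eq_mul]
      rw [show partialAvg w c 0 h x = h x from rfl]
      ring
    rw [← map_sum, ← h1, map_sub, map_smul, entropy, smul_eq_mul, mul_comm (expect w h)]
  rw [htel, Finset.mul_sum]
  refine Finset.sum_le_sum fun k _ => ?_
  rw [← expect_avg hs (c k), ← expect_avg hs (c k) ((g - avg w (c k) g) ^ 2), ← smul_eq_mul,
    ← map_smul]
  refine expect_mono hw0 fun x => ?_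
  have hG := sum_mul_log_le_entropy hw0 (h := fun a => h (Function.update x (c k) a))
    (b := fun a => partialAvg w c k h (Function.update x (c k) a)) (fun a => hnn _)
    (fun a => partialAvg_nonneg hw0 c k hnn _)
    (fun a => eq_zero_of_partialAvg_eq_zero hw0 c k hnn _)
  have hV := entropy_sq_le_variance hlam hw hs (fun a => g (Function.update x (c k) a))
  simp only [Pi.smul_apply, smul_eq_mul, avg_apply w (c k) _ x, partialAvg_succ, avg_update,
    Pi.pow_apply, Pi.sub_apply]
  exact hG.trans hV

/-- A function with small `L¹` norm compared to its `L²` norm has large entropy. The parameter `t`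
linearises the convex function `v ↦ v * log v`. -/
theorem le_entropy_sq (hw : ∀ a, 0 < w a) (g : (ι → Ω) → ℝ) {q t : ℝ}
    (hq : 0 < q) (ht : 0 < t) (hg : expect w |g| ≤ q) :
    expect w (g ^ 2) * (Real.log (t / q ^ 2) + 1) - t ≤ entropy w (g ^ 2) := by
  set v := expect w (g ^ 2) with hv
  have hv0 : 0 ≤ v := expect_nonneg hw fun x => sq_nonneg (g x)
  rcases hv0.eq_or_lt with h0 | hpos
  · have hz := eq_zero_of_expect_eq_zero hw (f := g ^ 2) (fun x => sq_nonneg (g x)) h0.symm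
    have hg0 : g ^ 2 = 0 := funext hz
    rw [← h0, hg0, entropy]
    simp only [Pi.zero_apply, zero_mul, map_zero, Real.log_zero]
    have : expect w (fun _ : ι → Ω => (0 : ℝ)) = 0 := map_zero (expect w)
    rw [this]
    linarith
  -- The tangent-line bound at height `v / q`, which balances the two error terms.
  have hpt : ∀ x, (2 * Real.log (v / q) + 2) * g x ^ 2 - 2 * (v / q) * |g x| ≤
      g x ^ 2 * Real.log (g x ^ 2) := by
    intro x
    rcases (abs_nonneg (g x)).eq_or_lt with hz | hy
    · have : g x = 0 := abs_eq_zero.1 hz.symm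
      simp [this]
    · have hτ : 0 < v / q := div_pos hpos hq
      have hl := Real.log_le_sub_one_of_pos (div_pos hτ hy)
      rw [Real.log_div hτ.ne' hy.ne'] at hl
      have h2 : |g x| ^ 2 * (v / q / |g x| - 1) = v / q * |g x| - |g x| ^ 2 := by
        field_simp
      have h3 := mul_le_mul_of_nonneg_left hl (sq_nonneg |g x|)
      rw [h2] at h3
      rw [← sq_abs, Real.log_pow]
      push_cast
      linarith
  have hE := expect_mono hw hpt
  have hlin : expect w (fun x => (2 * Real.log (v / q) + 2) * g x ^ 2 - 2 * (v / q) * |g x|) =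
      (2 * Real.log (v / q) + 2) * v - 2 * (v / q) * expect w |g| := by
    rw [hv, ← smul_eq_mul _ (expect w (g ^ 2)), ← smul_eq_mul _ (expect w |g|), ← map_smul,
      ← map_smul, ← map_sub]
    rfl
  rw [hlin] at hE
  have hq' : 2 * (v / q) * expect w |g| ≤ 2 * v := by
    calc 2 * (v / q) * expect w |g| ≤ 2 * (v / q) * q :=
          mul_le_mul_of_nonneg_left hg (by positivity)
      _ = 2 * v := by field_simp
  have htan : v * Real.log t + v - t ≤ v * Real.log v := by
    have hl := Real.log_le_sub_one_of_pos (div_pos ht hpos)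
    rw [Real.log_div ht.ne' hpos.ne'] at hl
    have := mul_le_mul_of_nonneg_left hl hv0
    have h2 : v * (t / v - 1) = t - v := by field_simp
    linarith
  have hent : entropy w (g ^ 2) =
      expect w (fun x => g x ^ 2 * Real.log (g x ^ 2)) - v * Real.log v := rfl
  rw [hent, Real.log_div ht.ne' (by positivity), Real.log_pow]
  rw [Real.log_div hpos.ne' hq.ne'] at hE
  push_cast
  linarith

end Entropy

end FiniteProduct

/-! ### Influences and the sharp threshold theorem -/

namespace FiniteProduct

section Threshold

variable {Ω : Type*} [Fintype Ω] {n : ℕ}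

/-- Small influences force many coordinates to matter (Kahn, Kalai and Linial, by the method of
Falik and Samorodnitsky): if every coordinate has `L¹` influence at most `r / n` and the variance is
at least `η`, then `η * log (η * n / r ^ 2)` is bounded in terms of `r`. The martingale differences
of `f` have small `L¹` norm, hence large entropy, while the logarithmic Sobolev inequality bounds
the sum of these entropies by the total influence. -/
theorem mul_log_le_of_influence_le (hn : 0 < n) {w : Ω → ℝ} {lam : ℝ} (hlam : 0 < lam)
    (hw : ∀ a, lam ≤ w a) (hs : ∑ a, w a = 1) {f : (Fin n → Ω) → ℝ} (hf0 : ∀ x, 0 ≤ f x)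
    (hf1 : ∀ x, f x ≤ 1) {r η : ℝ} (hr : 0 < r) (hη : 0 < η)
    (hinf : ∀ i, expect w |f - avg w i f| ≤ r / n)
    (hvar : η ≤ expect w (f ^ 2) - expect w f ^ 2) (hbig : 1 ≤ η * n / r ^ 2) :
    η * Real.log (η * n / r ^ 2) ≤ 4 / lam * r := by
  have hw0 : ∀ a, 0 < w a := fun a => hlam.trans_le (hw a)
  have hn' : (0 : ℝ) < n := Nat.cast_pos.2 hn
  set c : ℕ → Fin n := fun k => ⟨k % n, Nat.mod_lt k hn⟩
  have hci : ∀ i : Fin n, c i = i := fun i => Fin.ext (Nat.mod_eq_of_lt i.2)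
  have hc : ∀ i, ∃ l < n, c l = i := fun i => ⟨i, i.2, hci i⟩
  set d : ℕ → (Fin n → Ω) → ℝ := fun k => partialAvg w c k f - partialAvg w c (k + 1) f with hd
  have hd_eq : ∀ k, d k = partialAvg w c k (f - avg w (c k) f) := fun k => by
    rw [map_sub, ← avg_partialAvg, ← partialAvg_succ]
  have hvar_sum : ∀ g : (Fin n → Ω) → ℝ,
      ∑ k ∈ Finset.range n, expect w ((partialAvg w c k g - partialAvg w c (k + 1) g) ^ 2) =
        expect w (g ^ 2) - expect w g ^ 2 := fun g => by
    rw [sum_expect_diff_sq hs, partialAvg_eq_expect hs c n hc]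
    exact congrArg _ (expect_const hs _)
  have hL2 : ∀ i, expect w ((f - avg w i f) ^ 2) ≤ r / n := fun i => by
    refine le_trans (expect_mono hw0 fun x => ?_) (hinf i)
    have havg : avg w i f x ≤ 1 := by
      rw [avg_apply, ← hs]
      exact Finset.sum_le_sum fun a _ => mul_le_of_le_one_right (hw0 a).le (hf1 _)
    have hle : |f x - avg w i f x| ≤ 1 := by
      rw [abs_le]
      constructor <;> linarith [hf0 x, hf1 x, avg_nonneg hw0 i hf0 x]
    simp only [Pi.pow_apply, Pi.sub_apply, Pi.abs_apply]
    rw [← sq_abs, sq]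
    exact mul_le_of_le_one_right (abs_nonneg _) hle
  have hd1 : ∀ k, expect w |d k| ≤ r / n := fun k => by
    rw [hd_eq]
    exact (expect_abs_partialAvg_le hw0 hs c k _).trans (hinf _)
  have hq : 0 < r / n := by positivity
  have ht : 0 < η / n := by positivity
  have hratio : η / n / (r / n) ^ 2 = η * n / r ^ 2 := by
    field_simp
  have hupper : ∑ k ∈ Finset.range n, entropy w (d k ^ 2) ≤ 4 / lam * r := by
    calc ∑ k ∈ Finset.range n, entropy w (d k ^ 2)
        ≤ ∑ k ∈ Finset.range n, 4 / lam *
            ∑ j ∈ Finset.range n, expect w ((d k - avg w (c j) (d k)) ^ 2) :=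
          Finset.sum_le_sum fun k _ => entropy_sq_le hlam hw hs c n hc (d k)
      _ = 4 / lam * ∑ j ∈ Finset.range n,
            ∑ k ∈ Finset.range n, expect w ((d k - avg w (c j) (d k)) ^ 2) := by
          rw [← Finset.mul_sum, Finset.sum_comm]
      _ ≤ 4 / lam * ∑ j ∈ Finset.range n, r / n := by
          refine mul_le_mul_of_nonneg_left (Finset.sum_le_sum fun j _ => ?_) (by positivity)
          -- The martingale differences of `f - avg w (c j) f` are the `d k - avg w (c j) (d k)`.
          have hcomm : ∀ k, d k - avg w (c j) (d k) =
              partialAvg w c k (f - avg w (c j) f) -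
                partialAvg w c (k + 1) (f - avg w (c j) f) := fun k => by
            simp only [hd, map_sub, avg_partialAvg]
            abel
          simp only [hcomm]
          rw [hvar_sum]
          linarith [hL2 (c j), sq_nonneg (expect w (f - avg w (c j) f))]
      _ = 4 / lam * r := by
          rw [Finset.sum_const, Finset.card_range, nsmul_eq_mul, mul_div_cancel₀ _ hn'.ne']
  have hlower : (expect w (f ^ 2) - expect w f ^ 2) * (Real.log (η * n / r ^ 2) + 1) - η ≤
      ∑ k ∈ Finset.range n, entropy w (d k ^ 2) := by
    rw [← hvar_sum f, Finset.sum_mul]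
    have h := Finset.sum_le_sum fun k (_ : k ∈ Finset.range n) =>
      le_entropy_sq hw0 (d k) hq ht (hd1 k)
    rw [Finset.sum_sub_distrib, Finset.sum_const, Finset.card_range, nsmul_eq_mul,
      mul_div_cancel₀ _ hn'.ne', hratio] at h
    exact h
  have hlog := Real.log_nonneg hbig
  nlinarith

/-- The Margulis–Russo formula along the line `u + θ • μ` of weights. -/
theorem hasDerivAt_expect {u μ : Ω → ℝ} (f : (Fin n → Ω) → ℝ) (θ : ℝ)
    (hs : ∑ a, (u a + θ * μ a) = 1) :
    HasDerivAt (fun θ : ℝ => expect (fun a => u a + θ * μ a) f)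
      (∑ i, expect (fun a => u a + θ * μ a)
        (fun x => ∑ a, μ a * f (Function.update x i a))) θ := by
  simp only [expect_sum_update hs]
  rw [Finset.sum_comm]
  simp only [expect_apply]
  refine HasDerivAt.fun_sum fun x _ => ?_
  have h := HasDerivAt.fun_finsetProd (u := Finset.univ) (x := θ)
    (f := fun (i : Fin n) θ => u (x i) + θ * μ (x i)) (f' := fun i => μ (x i))
    (fun i _ => by simpa using ((hasDerivAt_id θ).mul_const (μ (x i))).const_add (u (x i)))
  simpa [Finset.sum_mul] using h.mul_const (f x)

theorem expect_comp_equiv (w : Ω → ℝ) (g : Equiv.Perm (Fin n)) (f : (Fin n → Ω) → ℝ) :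
    expect w (fun x => f (fun i => x (g i))) = expect w f := by
  rw [expect_apply, expect_apply]
  refine Fintype.sum_equiv (Equiv.arrowCongr g.symm (Equiv.refl Ω)) _ _ fun x => ?_
  have h : Equiv.arrowCongr g.symm (Equiv.refl Ω) x = fun i => x (g i) := by
    ext i
    simp
  rw [h, Equiv.prod_comp g fun i => w (x i)]

/-- Under a transitive symmetry group, all coordinates contribute equally to the derivative in the
Margulis–Russo formula. -/
theorem expect_sum_update_eq_of_isPretransitive (w v : Ω → ℝ) {f : (Fin n → Ω) → ℝ}
    {G : Subgroup (Equiv.Perm (Fin n))} (hG : MulAction.IsPretransitive G (Fin n))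
    (hf : ∀ g ∈ G, ∀ x : Fin n → Ω, f (fun i => x (g i)) = f x) (i j : Fin n) :
    expect w (fun x => ∑ a, v a * f (Function.update x i a)) =
      expect w (fun x => ∑ a, v a * f (Function.update x j a)) := by
  obtain ⟨⟨g, hg⟩, hgij⟩ := hG.exists_smul_eq i j
  have hgij : g i = j := hgij
  rw [← expect_comp_equiv w g]
  congr 1
  ext x
  refine Finset.sum_congr rfl fun a _ => ?_
  rw [← hf g hg (Function.update x j a)]
  congr 2
  ext k
  rcases eq_or_ne k i with rfl | hk
  · rw [Function.update_self, hgij, Function.update_self]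
  · rw [Function.update_of_ne hk, Function.update_of_ne (hgij ▸ g.injective.ne hk)]

/-- Qualitative sharp threshold: let `f` be a `{0, 1}`-valued function with a transitive symmetry
group whose derivative along the line `u + θ • μ` dominates its influences. If `f` has probability
at least `p` at `θ = 0`, then it has probability at least `δ` at `θ = 1`, as soon as the number of
coordinates is large. -/
theorem exists_sharp_threshold {lam R p δ : ℝ} (hlam : 0 < lam) (hR : 0 < R) (hp : 0 < p)
    (hδ : δ < 1) :
    ∃ N : ℕ, ∀ n, N < n → ∀ (Ω : Type*) [Fintype Ω] (u μ : Ω → ℝ),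
      ∑ a, u a = 1 → ∑ a, μ a = 0 →
      (∀ θ ∈ Set.Icc (0 : ℝ) 1, ∀ a, lam ≤ u a + θ * μ a) →
      ∀ f : (Fin n → Ω) → ℝ, (∀ x, f x = 0 ∨ f x = 1) →
      (∃ G : Subgroup (Equiv.Perm (Fin n)), MulAction.IsPretransitive G (Fin n) ∧
        ∀ g ∈ G, ∀ x : Fin n → Ω, f (fun i => x (g i)) = f x) →
      (∀ θ ∈ Set.Icc (0 : ℝ) 1, ∀ i x, |f x - avg (fun a => u a + θ * μ a) i f x| ≤
        R * ∑ a, μ a * f (Function.update x i a)) →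
      p ≤ expect u f → δ ≤ expect (fun a => u a + μ a) f := by
  set η : ℝ := p * (1 - δ)
  have hη : 0 < η := mul_pos hp (by linarith)
  have hlim : Filter.Tendsto (fun n : ℕ => η * (n : ℝ) / R ^ 2) Filter.atTop Filter.atTop :=
    (tendsto_natCast_atTop_atTop.const_mul_atTop hη).atTop_div_const (by positivity)
  obtain ⟨N, hN⟩ := Filter.eventually_atTop.1 ((hlim.eventually_ge_atTop 1).and
    ((Real.tendsto_log_atTop.comp hlim).const_mul_atTop hη |>.eventually_gt_atTop (4 / lam * R)))
  refine ⟨N, fun n hn Ω _ u μ hu hμ hw f hf hG hinf hp0 => ?_⟩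
  obtain ⟨G, hG, hfG⟩ := hG
  obtain ⟨hbig, hlarge⟩ := hN n hn.le
  have hn0 : 0 < n := (Nat.zero_le N).trans_lt hn
  have hn' : (0 : ℝ) < n := Nat.cast_pos.2 hn0
  have hf0 : ∀ x, 0 ≤ f x := fun x => by rcases hf x with h | h <;> simp [h]
  have hf1 : ∀ x, f x ≤ 1 := fun x => by rcases hf x with h | h <;> simp [h]
  have hs : ∀ θ : ℝ, ∑ a, (u a + θ * μ a) = 1 := fun θ => by
    rw [Finset.sum_add_distrib, ← Finset.mul_sum, hu, hμ]; ring
  by_contra! hlt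
  set h : ℝ → ℝ := fun θ => expect (fun a => u a + θ * μ a) f with hh
  set h' : ℝ → ℝ := fun θ => ∑ i, expect (fun a => u a + θ * μ a)
        (fun x => ∑ a, μ a * f (Function.update x i a)) with hh'
  have hder : ∀ θ, HasDerivAt h (h' θ) θ := fun θ => hasDerivAt_expect f θ (hs θ)
  have h0 : p ≤ h 0 := by simpa [hh] using hp0
  have h1 : h 1 < δ := by simpa [hh] using hlt
  have hcont : ContinuousOn h (Set.Icc 0 1) := fun θ _ => (hder θ).continuousAt.continuousWithinAt
  have hnn : ∀ θ ∈ Set.Icc (0 : ℝ) 1, 0 ≤ h' θ := fun θ hθ =>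
    Finset.sum_nonneg fun i _ => expect_nonneg (fun a => hlam.trans_le (hw θ hθ a)) fun x =>
      nonneg_of_mul_nonneg_right ((abs_nonneg _).trans (hinf θ hθ i x)) hR
  have hmono : MonotoneOn h (Set.Icc 0 1) := by
    refine monotoneOn_of_deriv_nonneg (convex_Icc 0 1) hcont
      (fun θ _ => (hder θ).differentiableAt.differentiableWithinAt) fun θ hθ => ?_
    rw [(hder θ).deriv]
    exact hnn θ (interior_subset hθ)
  obtain ⟨θ, hθ, hslope⟩ := exists_hasDerivAt_eq_slope h h' zero_lt_one hcont fun θ _ => hder θ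
  have hθ' := Set.Ioo_subset_Icc_self hθ
  have hl : h 0 ≤ h θ := hmono ⟨le_rfl, zero_le_one⟩ hθ' hθ.1.le
  have hr : h θ ≤ h 1 := hmono hθ' ⟨zero_le_one, le_rfl⟩ hθ.2.le
  have hder1 : h' θ ≤ 1 := by rw [hslope]; linarith
  -- By symmetry every influence is at most `R / n`.
  have hinf' : ∀ i, expect (fun a => u a + θ * μ a) |f - avg (fun a => u a + θ * μ a) i f| ≤
      R / n := fun i => by
    have hle := expect_mono (fun a => hlam.trans_le (hw θ hθ' a)) (hinf θ hθ' i)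
    have hsum : h' θ = n * expect (fun a => u a + θ * μ a)
        (fun x => ∑ a, μ a * f (Function.update x i a)) := by
      simp only [hh']
      rw [Finset.sum_congr rfl fun j _ =>
        expect_sum_update_eq_of_isPretransitive (fun a => u a + θ * μ a) μ hG hfG j i]
      simp
    have hsm : expect (fun a => u a + θ * μ a)
        (fun x => R * ∑ a, μ a * f (Function.update x i a)) =
        R * expect (fun a => u a + θ * μ a) (fun x => ∑ a, μ a * f (Function.update x i a)) :=
      map_smul (expect (fun a => u a + θ * μ a)) R _
    rw [hsm] at hle
    refine le_trans hle ?_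
    rw [le_div_iff₀ hn']
    rw [hsum] at hder1
    nlinarith
  have hvar : η ≤ expect (fun a => u a + θ * μ a) (f ^ 2) -
      expect (fun a => u a + θ * μ a) f ^ 2 := by
    have hsq : f ^ 2 = f := by
      ext x
      rcases hf x with h | h <;> simp [h]
    rw [hsq]
    change η ≤ h θ - h θ ^ 2
    have ha : p ≤ h θ := h0.trans hl
    have hb : 1 - δ ≤ 1 - h θ := by linarith
    calc η ≤ h θ * (1 - h θ) := mul_le_mul ha hb (by linarith) (by linarith)
      _ = h θ - h θ ^ 2 := by ring
  exact absurd (mul_log_le_of_influence_le hn0 hlam (hw θ hθ') (hs θ) hf0 hf1 hR hη hinf' hvar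
    hbig) (not_le.2 hlarge)

end Threshold

end FiniteProduct

/-! ### Random orderings with prescribed plurality winners -/

namespace PermOrder

section Orderings

variable {X : Type*} [Fintype X] [DecidableEq X]

/-- The indicator of the event that `t` is the highest ranked alternative of `S`, for the ranking
in which `π x` is the position of `x`, larger positions being better. -/
noncomputable def topInd (S : Finset X) (t : X) (π : X ≃ Fin (Fintype.card X)) : ℝ :=
  if t ∈ S ∧ ∀ x ∈ S, π x ≤ π t then 1 else 0

/-- The indicator of the event that every alternative of `S` is ranked below every alternative
outside `S`. -/
noncomputable def bottomInd (S : Finset X) (π : X ≃ Fin (Fintype.card X)) : ℝ :=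
  if ∀ x ∈ S, ∀ y ∉ S, π x < π y then 1 else 0

omit [DecidableEq X] in
theorem topInd_unique {S : Finset X} {s t : X} {π : X ≃ Fin (Fintype.card X)}
    (hs : s ∈ S ∧ ∀ x ∈ S, π x ≤ π s) (ht : t ∈ S ∧ ∀ x ∈ S, π x ≤ π t) : s = t :=
  π.injective (le_antisymm (ht.2 s hs.1) (hs.2 t ht.1))

theorem sum_topInd {S : Finset X} (hS : S.Nonempty) (π : X ≃ Fin (Fintype.card X)) :
    ∑ t ∈ S, topInd S t π = 1 := by
  obtain ⟨s, hs, hmax⟩ := S.exists_max_image π hS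
  rw [Finset.sum_eq_single_of_mem s hs, topInd, if_pos ⟨hs, hmax⟩]
  intro t _ hts
  exact if_neg fun h => hts (topInd_unique h ⟨hs, hmax⟩)

omit [Fintype X] in
theorem swap_mem {S : Finset X} {s t : X} (hs : s ∈ S) (ht : t ∈ S) (x : X) :
    Equiv.swap s t x ∈ S ↔ x ∈ S := by
  rw [Equiv.swap_apply_def]
  split_ifs with h1 h2
  · subst h1; simp [hs, ht]
  · subst h2; simp [hs, ht]
  · rfl

omit [Fintype X] in
theorem forall_swap_mem {S : Finset X} {s t : X} (hs : s ∈ S) (ht : t ∈ S) (p : X → Prop) :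
    (∀ x ∈ S, p (Equiv.swap s t x)) ↔ ∀ x ∈ S, p x := by
  refine ⟨fun h x hx => ?_, fun h x hx => h _ ((swap_mem hs ht x).2 hx)⟩
  simpa using h (Equiv.swap s t x) ((swap_mem hs ht x).2 hx)

theorem topInd_swap {S : Finset X} {s t : X} (hs : s ∈ S) (ht : t ∈ S) (z : X)
    (π : X ≃ Fin (Fintype.card X)) :
    topInd S z ((Equiv.swap s t).trans π) = topInd S (Equiv.swap s t z) π := by
  exact if_congr (and_congr (swap_mem hs ht z).symm
    (forall_swap_mem hs ht fun y => π y ≤ π (Equiv.swap s t z))) rfl rfl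

theorem bottomInd_swap {S : Finset X} {s t : X} (hs : s ∈ S) (ht : t ∈ S)
    (π : X ≃ Fin (Fintype.card X)) :
    bottomInd S ((Equiv.swap s t).trans π) = bottomInd S π := by
  have h : ∀ y, y ∉ S → Equiv.swap s t y = y := fun y hy =>
    Equiv.swap_apply_of_ne_of_ne (fun h => hy (h ▸ hs)) (fun h => hy (h ▸ ht))
  have hiff : (∀ x ∈ S, ∀ y ∉ S, π (Equiv.swap s t x) < π (Equiv.swap s t y)) ↔
      ∀ x ∈ S, ∀ y ∉ S, π x < π y := by
    rw [← forall_swap_mem hs ht fun x => ∀ y ∉ S, π x < π y]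
    exact forall₂_congr fun x _ => forall₂_congr fun y hy => by rw [h y hy]
  simp only [bottomInd, Equiv.trans_apply, hiff]

/-- If a weight on rankings is invariant under exchanging alternatives of `T`, then each alternative
of `T` is the highest of `T` with the same weight. -/
theorem sum_mul_topInd {T : Finset X} {B : (X ≃ Fin (Fintype.card X)) → ℝ}
    (hB : ∀ s ∈ T, ∀ t ∈ T, ∀ π, B ((Equiv.swap s t).trans π) = B π) {t : X} (ht : t ∈ T) :
    ∑ π, B π * topInd T t π = (∑ π, B π) / T.card := by
  have hne : T.Nonempty := ⟨t, ht⟩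
  have heq : ∀ s ∈ T, ∑ π, B π * topInd T s π = ∑ π, B π * topInd T t π := by
    intro s hs
    refine Fintype.sum_equiv (Equiv.equivCongr (Equiv.swap s t) (Equiv.refl _)) _ _ fun π => ?_
    have h : Equiv.equivCongr (Equiv.swap s t) (Equiv.refl _) π = (Equiv.swap s t).trans π := by
      ext x
      simp
    rw [h, hB s hs t ht, topInd_swap hs ht, Equiv.swap_apply_right]
  have hsum : ∑ s ∈ T, ∑ π, B π * topInd T s π = ∑ π, B π := by
    rw [Finset.sum_comm]
    refine Finset.sum_congr rfl fun π _ => ?_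
    rw [← Finset.mul_sum, sum_topInd hne, mul_one]
  rw [Finset.sum_congr rfl heq, Finset.sum_const, nsmul_eq_mul] at hsum
  rw [eq_div_iff (Nat.cast_ne_zero.2 hne.card_pos.ne'), mul_comm, hsum]

/-- The number of rankings with `S` at the bottom. -/
noncomputable def bottomCount (S : Finset X) : ℝ := ∑ π, bottomInd S π

theorem one_le_bottomCount (S : Finset X) : 1 ≤ bottomCount S := by
  have hcard : Fintype.card {x // x ∈ S} + Fintype.card {x // x ∉ S} = Fintype.card X := by
    rw [← Fintype.card_sum]
    exact Fintype.card_congr (Equiv.sumCompl _)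
  let π : X ≃ Fin (Fintype.card X) :=
    (Equiv.sumCompl (· ∈ S)).symm.trans (((Fintype.equivFin _).sumCongr
      (Fintype.equivFin _)).trans (finSumFinEquiv.trans (finCongr hcard)))
  have hπ : bottomInd S π = 1 := by
    refine if_pos fun x hx y hy => ?_
    simp only [π, Equiv.trans_apply, Equiv.sumCompl_symm_apply_of_pos hx,
      Equiv.sumCompl_symm_apply_of_neg hy]
    simp only [Equiv.sumCongr_apply, Sum.map_inl, Sum.map_inr, finSumFinEquiv_apply_left,
      finSumFinEquiv_apply_right, finCongr_apply, Fin.lt_def, Fin.val_cast, Fin.val_castAdd,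
      Fin.val_natAdd]
    exact Nat.lt_add_right _ (Fin.is_lt _)
  rw [← hπ]
  exact Finset.single_le_sum (f := bottomInd S)
    (fun π _ => by unfold bottomInd; split_ifs <;> norm_num) (Finset.mem_univ π)

/-- The signed weight that places `S` at the bottom and moves `s` to the top of `S`, compared to a
uniform arrangement of `S`. -/
noncomputable def raise (S : Finset X) (s : X) (π : X ≃ Fin (Fintype.card X)) : ℝ :=
  bottomInd S π * (S.card * topInd S s π - 1) / bottomCount S

theorem sum_bottomInd_mul_topInd {S T : Finset X} (hTS : T ⊆ S) {t : X} (ht : t ∈ T) :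
    ∑ π, bottomInd S π * topInd T t π = bottomCount S / T.card :=
  sum_mul_topInd (fun _ ha _ hb π => bottomInd_swap (hTS ha) (hTS hb) π) ht

theorem sum_raise {S : Finset X} {s : X} (hs : s ∈ S) : ∑ π, raise S s π = 0 := by
  have hS : (S.card : ℝ) ≠ 0 := Nat.cast_ne_zero.2 (Finset.card_ne_zero_of_mem hs)
  have h : ∀ π, bottomInd S π * (S.card * topInd S s π - 1) =
      S.card * (bottomInd S π * topInd S s π) - bottomInd S π := fun π => by ring
  simp only [raise, h]
  rw [← Finset.sum_div, Finset.sum_sub_distrib, ← Finset.mul_sum,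
    sum_bottomInd_mul_topInd subset_rfl hs, mul_div_cancel₀ _ hS, bottomCount, sub_self, zero_div]

/-- Raising `s` within the bottom block `S` shifts the top choice from `T` towards `s` if
`s ∈ T ⊆ S`, and does not change its distribution for any other `T`. -/
theorem sum_raise_mul_topInd {S T : Finset X} {s t : X} (hs : s ∈ S) (ht : t ∈ T) :
    ∑ π, raise S s π * topInd T t π =
      if T ⊆ S ∧ s ∈ T then (if s = t then 1 else 0) - 1 / (T.card : ℝ) else 0 := by
  have hS : (S.card : ℝ) ≠ 0 := Nat.cast_ne_zero.2 (Finset.card_ne_zero_of_mem hs)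
  have hT : (T.card : ℝ) ≠ 0 := Nat.cast_ne_zero.2 (Finset.card_ne_zero_of_mem ht)
  have hN : bottomCount S ≠ 0 := (zero_lt_one.trans_le (one_le_bottomCount S)).ne'
  have hexp : ∑ π, raise S s π * topInd T t π =
      (S.card * ∑ π, bottomInd S π * topInd S s π * topInd T t π -
        ∑ π, bottomInd S π * topInd T t π) / bottomCount S := by
    rw [Finset.mul_sum, ← Finset.sum_sub_distrib, Finset.sum_div]
    exact Finset.sum_congr rfl fun π _ => by rw [raise]; ring
  rw [hexp]
  by_cases hTS : T ⊆ S
  · rw [sum_bottomInd_mul_topInd hTS ht]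
    by_cases hsT : s ∈ T
    · rw [if_pos ⟨hTS, hsT⟩]
      have h : ∀ π, bottomInd S π * topInd S s π * topInd T t π =
          (if s = t then 1 else 0) * (bottomInd S π * topInd S s π) := by
        intro π
        by_cases hp : s ∈ S ∧ ∀ x ∈ S, π x ≤ π s
        · have hsT' : s ∈ T ∧ ∀ x ∈ T, π x ≤ π s := ⟨hsT, fun x hx => hp.2 x (hTS hx)⟩
          have : topInd T t π = if s = t then 1 else 0 := by
            by_cases hst : s = t
            · rw [if_pos hst, topInd, if_pos (hst ▸ hsT')]
            · rw [if_neg hst, topInd, if_neg fun h => hst (topInd_unique hsT' h)]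
          rw [this, mul_comm]
        · simp [topInd, if_neg hp]
      simp only [h]
      rw [← Finset.mul_sum, sum_bottomInd_mul_topInd subset_rfl hs]
      field_simp
    · rw [if_neg fun h => hsT h.2]
      -- Exchanging two alternatives of `T` does not move `s`.
      rw [sum_mul_topInd (B := fun π => bottomInd S π * topInd S s π) (fun a ha b hb π => by
        rw [bottomInd_swap (hTS ha) (hTS hb), topInd_swap (hTS ha) (hTS hb),
          Equiv.swap_apply_of_ne_of_ne (ne_of_mem_of_not_mem ha hsT).symm
            (ne_of_mem_of_not_mem hb hsT).symm]) ht,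
        sum_bottomInd_mul_topInd subset_rfl hs]
      field_simp
      ring
  · rw [if_neg fun h => hTS h.1]
    obtain ⟨y, hyT, hyS⟩ := Finset.not_subset.1 hTS
    -- With `S` at the bottom, the top choice from `T` does not depend on the arrangement of `S`.
    have hinv : ∀ a ∈ S, ∀ b ∈ S, ∀ π : X ≃ Fin (Fintype.card X),
        bottomInd S ((Equiv.swap a b).trans π) * topInd T t ((Equiv.swap a b).trans π) =
          bottomInd S π * topInd T t π := by
      intro a ha b hb π
      rw [bottomInd_swap ha hb]
      by_cases hbot : ∀ x ∈ S, ∀ y ∉ S, π x < π y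
      · have hfix : ∀ y, y ∉ S → Equiv.swap a b y = y := fun y hy =>
          Equiv.swap_apply_of_ne_of_ne (fun h => hy (h ▸ ha)) (fun h => hy (h ▸ hb))
        congr 1
        simp only [topInd, Equiv.trans_apply]
        refine if_congr (and_congr_right fun _ => ?_) rfl rfl
        by_cases htS : t ∈ S
        · refine iff_of_false (fun h => ?_) fun h => ?_
          · have h1 := h y hyT
            rw [hfix y hyS] at h1
            exact (hbot _ ((swap_mem ha hb t).2 htS) y hyS).not_ge h1
          · exact (hbot t htS y hyS).not_ge (h y hyT)
        · refine forall₂_congr fun x _ => ?_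
          rw [hfix t htS]
          by_cases hxS : x ∈ S
          · exact iff_of_true (hbot _ ((swap_mem ha hb x).2 hxS) t htS).le (hbot x hxS t htS).le
          · rw [hfix x hxS]
      · simp [bottomInd, if_neg hbot]
    have h := sum_mul_topInd (B := fun π => bottomInd S π * topInd T t π) hinv hs
    simp only [mul_right_comm _ (topInd T t _)] at h
    rw [h, mul_div_cancel₀ _ hS, sub_self, zero_div]

theorem abs_raise_le (S : Finset X) (s : X) (π : X ≃ Fin (Fintype.card X)) :
    |raise S s π| ≤ Fintype.card X + 1 := by
  have hN := one_le_bottomCount S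
  have hcard : (S.card : ℝ) ≤ Fintype.card X := Nat.cast_le.2 S.card_le_univ
  have hS0 : (0 : ℝ) ≤ S.card := Nat.cast_nonneg _
  rw [raise, abs_div, abs_of_pos (zero_lt_one.trans_le hN),
    div_le_iff₀ (zero_lt_one.trans_le hN)]
  have h1 : |bottomInd S π * (S.card * topInd S s π - 1)| ≤ Fintype.card X + 1 := by
    unfold bottomInd topInd
    rw [abs_le]
    split_ifs <;> constructor <;> nlinarith
  refine h1.trans (le_mul_of_one_le_right (by linarith) hN)

/-! ### Möbius inversion over supersets -/

/-- The coefficients with superset sums `b`. -/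
noncomputable def moebius (b : Finset X → ℝ) (S : Finset X) : ℝ :=
  ∑ R with S ⊆ R, (-1) ^ (R \ S).card * b R

omit [Fintype X] in
theorem sum_Icc_neg_one_pow_card_sdiff (T R : Finset X) :
    ∑ S ∈ Finset.Icc T R, (-1 : ℝ) ^ (R \ S).card = if T = R then 1 else 0 := by
  by_cases hTR : T ⊆ R
  · have h : ∑ S ∈ Finset.Icc T R, (-1 : ℝ) ^ (R \ S).card =
        ∑ S ∈ (R \ T).powerset, (-1 : ℝ) ^ S.card := by
      refine Finset.sum_nbij' (fun S => R \ S) (fun S => R \ S) ?_ ?_ ?_ ?_ ?_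
      · intro S hS
        rw [Finset.mem_Icc] at hS
        exact Finset.mem_powerset.2 (Finset.sdiff_subset_sdiff subset_rfl hS.1)
      · intro S hS
        rw [Finset.mem_powerset] at hS
        refine Finset.mem_Icc.2 ⟨fun x hx => ?_, Finset.sdiff_subset⟩
        exact Finset.mem_sdiff.2 ⟨hTR hx, fun h => (Finset.mem_sdiff.1 (hS h)).2 hx⟩
      · intro S hS
        exact Finset.sdiff_sdiff_eq_self (Finset.mem_Icc.1 hS).2
      · intro S hS
        exact Finset.sdiff_sdiff_eq_self ((Finset.mem_powerset.1 hS).trans Finset.sdiff_subset)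
      · intro S _
        rfl
    have h2 := congrArg (Int.cast : ℤ → ℝ)
      (Finset.sum_powerset_neg_one_pow_card (x := R \ T))
    push_cast at h2
    rw [h, h2]
    refine if_congr ?_ rfl rfl
    rw [Finset.sdiff_eq_empty_iff_subset]
    exact ⟨fun h => hTR.antisymm h, fun h => h ▸ subset_rfl⟩
  · rw [Finset.Icc_eq_empty fun h => hTR h, Finset.sum_empty, if_neg fun h => hTR h.subset]

theorem sum_moebius (b : Finset X → ℝ) (T : Finset X) :
    ∑ S with T ⊆ S, moebius b S = b T := by
  unfold moebius
  rw [Finset.sum_comm' (t' := Finset.univ) (s' := fun R => Finset.Icc T R)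
    (by intro S R; simp [Finset.mem_Icc])]
  simp only [← Finset.sum_mul, sum_Icc_neg_one_pow_card_sdiff, ite_mul, one_mul, zero_mul]
  simp

theorem abs_moebius_le {b : Finset X → ℝ} (hb : ∀ R, |b R| ≤ 1) (S : Finset X) :
    |moebius b S| ≤ 2 ^ Fintype.card X := by
  calc |moebius b S| ≤ ∑ R with S ⊆ R, |(-1) ^ (R \ S).card * b R| :=
        Finset.abs_sum_le_sum_abs _ _
    _ ≤ ∑ R : Finset X, (1 : ℝ) := by
        refine (Finset.sum_le_sum_of_subset_of_nonneg (Finset.filter_subset _ _)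
          fun _ _ _ => abs_nonneg _).trans (Finset.sum_le_sum fun R _ => ?_)
        rw [abs_mul, abs_pow, abs_neg, abs_one, one_pow, one_mul]
        exact hb R
    _ = 2 ^ Fintype.card X := by simp

end Orderings

end PermOrder

/-! ### The tilted law of a random ordering -/

namespace PermOrder

open FiniteProduct

section Law

variable {X : Type*} [Fintype X] [DecidableEq X]

/-- The indicator that `c₀` chooses `s` from `R`, extended by `0` to the empty set. -/
noncomputable def choiceInd (c₀ : ChoiceFunction X) (s : X) (R : Finset X) : ℝ :=
  if h : R.Nonempty then if c₀.choice ⟨R, h⟩ = s then 1 else 0 else 0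

omit [Fintype X] in
theorem abs_choiceInd_le (c₀ : ChoiceFunction X) (s : X) (R : Finset X) :
    |choiceInd c₀ s R| ≤ 1 := by
  unfold choiceInd
  split_ifs <;> simp

/-- The signed weight on rankings that moves the top choice from every set towards the choice
of `c₀`, and treats the other alternatives of the set equally. -/
noncomputable def tilt (c₀ : ChoiceFunction X) (π : X ≃ Fin (Fintype.card X)) : ℝ :=
  ∑ S : Finset X, ∑ s ∈ S, moebius (choiceInd c₀ s) S * raise S s π

theorem sum_tilt (c₀ : ChoiceFunction X) : ∑ π, tilt c₀ π = 0 := by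
  unfold tilt
  rw [Finset.sum_comm]
  refine Finset.sum_eq_zero fun S _ => ?_
  rw [Finset.sum_comm]
  exact Finset.sum_eq_zero fun s hs => by rw [← Finset.mul_sum, sum_raise hs, mul_zero]

theorem sum_tilt_mul_topInd (c₀ : ChoiceFunction X) (T : NonemptySubset X) {t : X}
    (ht : t ∈ T.1) :
    ∑ π, tilt c₀ π * topInd T.1 t π =
      (if c₀.choice T = t then 1 else 0) - 1 / (T.1.card : ℝ) := by
  have h1 : ∑ π, tilt c₀ π * topInd T.1 t π =
      ∑ S : Finset X, ∑ s ∈ S, moebius (choiceInd c₀ s) S *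
        if T.1 ⊆ S ∧ s ∈ T.1 then (if s = t then 1 else 0) - 1 / (T.1.card : ℝ) else 0 := by
    simp only [tilt, Finset.sum_mul]
    rw [Finset.sum_comm]
    refine Finset.sum_congr rfl fun S _ => ?_
    rw [Finset.sum_comm]
    refine Finset.sum_congr rfl fun s hs => ?_
    rw [← sum_raise_mul_topInd hs ht, Finset.mul_sum]
    exact Finset.sum_congr rfl fun π _ => mul_assoc _ _ _
  have h2 : ∀ S : Finset X, (∑ s ∈ S, moebius (choiceInd c₀ s) S *
        if T.1 ⊆ S ∧ s ∈ T.1 then (if s = t then 1 else 0) - 1 / (T.1.card : ℝ) else 0) =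
      if T.1 ⊆ S then ∑ s ∈ T.1, moebius (choiceInd c₀ s) S *
        ((if s = t then 1 else 0) - 1 / (T.1.card : ℝ)) else 0 := by
    intro S
    by_cases hTS : T.1 ⊆ S
    · rw [if_pos hTS]
      simp only [hTS, true_and, mul_ite, mul_zero]
      rw [← Finset.sum_filter, Finset.filter_mem_eq_inter, Finset.inter_eq_right.2 hTS]
    · simp [hTS]
  rw [h1, Finset.sum_congr rfl fun S _ => h2 S, ← Finset.sum_filter, Finset.sum_comm]
  simp only [← Finset.sum_mul, sum_moebius]
  rw [Finset.sum_eq_single_of_mem (c₀.choice T) (c₀.choice_mem T)]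
  · simp [choiceInd, T.2]
  · intro s _ hs
    simp [choiceInd, T.2, hs.symm]

/-- A bound for the signed weight `tilt` on `m` alternatives. -/
noncomputable def tiltBound (m : ℕ) : ℝ := 2 ^ m * (m * (2 ^ m * (m + 1)))

theorem abs_tilt_le (c₀ : ChoiceFunction X) (π : X ≃ Fin (Fintype.card X)) :
    |tilt c₀ π| ≤ tiltBound (Fintype.card X) := by
  have hterm : ∀ S : Finset X, |∑ s ∈ S, moebius (choiceInd c₀ s) S * raise S s π| ≤
      Fintype.card X * (2 ^ Fintype.card X * (Fintype.card X + 1)) := by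
    intro S
    calc |∑ s ∈ S, moebius (choiceInd c₀ s) S * raise S s π|
        ≤ ∑ s ∈ S, (2 ^ Fintype.card X * (Fintype.card X + 1) : ℝ) := by
          refine (Finset.abs_sum_le_sum_abs _ _).trans (Finset.sum_le_sum fun s _ => ?_)
          rw [abs_mul]
          exact mul_le_mul (abs_moebius_le (abs_choiceInd_le c₀ s) S) (abs_raise_le S s π)
            (abs_nonneg _) (by positivity)
      _ = S.card * (2 ^ Fintype.card X * (Fintype.card X + 1)) := by
          rw [Finset.sum_const, nsmul_eq_mul]
      _ ≤ _ := mul_le_mul_of_nonneg_right (Nat.cast_le.2 S.card_le_univ) (by positivity)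
  calc |tilt c₀ π|
      ≤ ∑ S : Finset X,
          (Fintype.card X * (2 ^ Fintype.card X * (Fintype.card X + 1)) : ℝ) :=
        (Finset.abs_sum_le_sum_abs _ _).trans (Finset.sum_le_sum fun S _ => hterm S)
    _ = tiltBound (Fintype.card X) := by simp [tiltBound]

/-- Half the uniform weight of a ranking of `m` alternatives. -/
noncomputable def minWeight (m : ℕ) : ℝ := 1 / (2 * m.factorial)

/-- The size of the perturbation of the uniform weights, small enough for all weights to remain at
least half of the uniform one. -/
noncomputable def tiltScale (m : ℕ) : ℝ := minWeight m / (tiltBound m + 1)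

theorem minWeight_pos (m : ℕ) : 0 < minWeight m := by
  unfold minWeight
  positivity

theorem tiltBound_nonneg (m : ℕ) : 0 ≤ tiltBound m := by
  unfold tiltBound
  positivity

theorem tiltScale_pos (m : ℕ) : 0 < tiltScale m :=
  div_pos (minWeight_pos m) (by linarith [tiltBound_nonneg m])

/-- The uniform weight of a ranking. -/
noncomputable def uniformWeight (_ : X ≃ Fin (Fintype.card X)) : ℝ :=
  1 / (Fintype.card X).factorial

theorem sum_uniformWeight : ∑ π : X ≃ Fin (Fintype.card X), uniformWeight π = 1 := by
  have h : ((Fintype.card X).factorial : ℝ) ≠ 0 := Nat.cast_ne_zero.2 (Nat.factorial_ne_zero _)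
  simp [uniformWeight, Fintype.card_equiv (Fintype.equivFin X), h]

theorem minWeight_le (c₀ : ChoiceFunction X) {θ : ℝ} (hθ : θ ∈ Set.Icc (0 : ℝ) 1)
    (π : X ≃ Fin (Fintype.card X)) :
    minWeight (Fintype.card X) ≤
      uniformWeight π + θ * (tiltScale (Fintype.card X) * tilt c₀ π) := by
  have hB := tiltBound_nonneg (Fintype.card X)
  have hε := tiltScale_pos (Fintype.card X)
  have h1 : tiltScale (Fintype.card X) * |tilt c₀ π| ≤ minWeight (Fintype.card X) := by
    calc tiltScale (Fintype.card X) * |tilt c₀ π|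
        ≤ tiltScale (Fintype.card X) * (tiltBound (Fintype.card X) + 1) :=
          mul_le_mul_of_nonneg_left (by linarith [abs_tilt_le c₀ π]) hε.le
      _ = minWeight (Fintype.card X) := div_mul_cancel₀ _ (by positivity)
  have h2 : |θ * (tiltScale (Fintype.card X) * tilt c₀ π)| ≤ minWeight (Fintype.card X) := by
    rw [abs_mul, abs_mul, abs_of_pos hε, abs_of_nonneg hθ.1]
    exact (mul_le_of_le_one_left (by positivity) hθ.2).trans h1
  have h3 : uniformWeight π = 2 * minWeight (Fintype.card X) := by
    unfold uniformWeight minWeight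
    field_simp
  linarith [neg_le_of_abs_le h2]

/-- The weights of the random ranking: uniform up to a small tilt towards `c₀`. -/
noncomputable def tiltedWeight (c₀ : ChoiceFunction X) (π : X ≃ Fin (Fintype.card X)) : ℝ :=
  uniformWeight π + tiltScale (Fintype.card X) * tilt c₀ π

theorem tiltedWeight_pos (c₀ : ChoiceFunction X) (π : X ≃ Fin (Fintype.card X)) :
    0 < tiltedWeight c₀ π := by
  have h := minWeight_le c₀ (θ := 1) ⟨zero_le_one, le_rfl⟩ π
  rw [one_mul] at h
  exact (minWeight_pos _).trans_le h

theorem sum_scaled_tilt (c₀ : ChoiceFunction X) :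
    ∑ π, tiltScale (Fintype.card X) * tilt c₀ π = 0 := by
  rw [← Finset.mul_sum, sum_tilt, mul_zero]

theorem sum_tiltedWeight (c₀ : ChoiceFunction X) : ∑ π, tiltedWeight c₀ π = 1 := by
  unfold tiltedWeight
  rw [Finset.sum_add_distrib, sum_uniformWeight, sum_scaled_tilt, add_zero]

/-- The linear ordering of the alternatives by their positions in the ranking `π`. -/
abbrev toLinearOrder (π : X ≃ Fin (Fintype.card X)) : LinearOrder X :=
  LinearOrder.lift' π π.injective

/-- The distribution of the random ordering. -/
noncomputable def tiltedLaw (c₀ : ChoiceFunction X) : PMF (LinearOrder X) :=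
  (PMF.ofFintype (fun π => ENNReal.ofReal (tiltedWeight c₀ π)) (by
    rw [← ENNReal.ofReal_sum_of_nonneg fun π _ => (tiltedWeight_pos c₀ π).le, sum_tiltedWeight,
      ENNReal.ofReal_one])).map toLinearOrder

/-- The probability of an event for independent orderings, bounded below by a finite expectation
over rankings. (Equality holds, but needs measurability of the event.) -/
theorem expect_le_iidOrderings (c₀ : ChoiceFunction X) (n : ℕ)
    (B : Set (Fin n → LinearOrder X)) [DecidablePred (· ∈ B)] :
    expect (tiltedWeight c₀) (fun x => if (fun i => toLinearOrder (x i)) ∈ B then 1 else 0) ≤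
      (iidOrderings (tiltedLaw c₀) n).real B := by
  let _ : MeasurableSpace (X ≃ Fin (Fintype.card X)) := ⊤
  have : MeasurableSingletonClass (X ≃ Fin (Fintype.card X)) := ⟨fun _ => trivial⟩
  set p : PMF (X ≃ Fin (Fintype.card X)) :=
    PMF.ofFintype (fun π => ENNReal.ofReal (tiltedWeight c₀ π)) (by
      rw [← ENNReal.ofReal_sum_of_nonneg fun π _ => (tiltedWeight_pos c₀ π).le, sum_tiltedWeight,
        ENNReal.ofReal_one]) with hp
  have hmeas : Measurable (toLinearOrder : (X ≃ Fin (Fintype.card X)) → LinearOrder X) :=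
    measurable_from_top
  have hmap : iidOrderings (tiltedLaw c₀) n =
      (Measure.pi fun _ : Fin n => p.toMeasure).map (fun x i => toLinearOrder (x i)) := by
    rw [Measure.pi_map_pi fun _ => hmeas.aemeasurable]
    simp only [PMF.toMeasure_map toLinearOrder p hmeas]
    rfl
  set ρ := Measure.pi fun _ : Fin n => p.toMeasure with hρ
  have hsingle : ∀ x : Fin n → (X ≃ Fin (Fintype.card X)),
      ρ.real {x} = ∏ i, tiltedWeight c₀ (x i) := fun x => by
    rw [Measure.real, hρ, Measure.pi_singleton, ENNReal.toReal_prod]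
    refine Finset.prod_congr rfl fun i _ => ?_
    rw [PMF.toMeasure_apply_singleton _ _ (MeasurableSet.singleton _), hp, PMF.ofFintype_apply,
      ENNReal.toReal_ofReal (tiltedWeight_pos c₀ _).le]
  have hfun : AEMeasurable (fun (x : Fin n → (X ≃ Fin (Fintype.card X))) i =>
      toLinearOrder (x i)) ρ := (measurable_of_finite _).aemeasurable
  have hsum : expect (tiltedWeight c₀)
      (fun x => if (fun i => toLinearOrder (x i)) ∈ B then 1 else 0) =
        ρ.real ((fun x i => toLinearOrder (x i)) ⁻¹' B) := by
    have hset : ((fun (x : Fin n → (X ≃ Fin (Fintype.card X))) i => toLinearOrder (x i)) ⁻¹' B) =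
        ↑(Finset.univ.filter fun x : Fin n → (X ≃ Fin (Fintype.card X)) =>
          (fun i => toLinearOrder (x i)) ∈ B) := by
      ext x
      simp
    rw [hset, ← sum_measureReal_singleton, expect_apply, Finset.sum_filter]
    refine Finset.sum_congr rfl fun x _ => ?_
    rw [hsingle]
    split_ifs <;> simp
  rw [hsum, hmap]
  have : IsProbabilityMeasure (ρ.map fun x i => toLinearOrder (x i)) :=
    Measure.isProbabilityMeasure_map hfun
  exact ENNReal.toReal_mono (measure_ne_top _ _) (Measure.le_map_apply hfun B)

end Law

/-! ### Social choice as a function of rankings -/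

section Social

variable {X : Type*} [Fintype X] [DecidableEq X] {n : ℕ}

omit [DecidableEq X] in
theorem topChoice_eq_iff (π : X ≃ Fin (Fintype.card X)) (S : NonemptySubset X) (t : X) :
    (topChoice (toLinearOrder π)).1.choice S = t ↔ t ∈ S.1 ∧ ∀ x ∈ S.1, π x ≤ π t := by
  have h : (topChoice (toLinearOrder π)).1.choice S ∈ S.1 ∧
      ∀ x ∈ S.1, π x ≤ π ((topChoice (toLinearOrder π)).1.choice S) :=
    ⟨(topChoice (toLinearOrder π)).1.choice_mem S, fun x hx =>
      @Finset.le_max' X (toLinearOrder π) S.1 x hx⟩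
  exact ⟨fun ht => ht ▸ h, fun ht => topInd_unique h ht⟩

theorem topInd_eq (S : NonemptySubset X) (t : X) (π : X ≃ Fin (Fintype.card X)) :
    topInd S.1 t π = if (topChoice (toLinearOrder π)).1.choice S = t then 1 else 0 :=
  if_congr (topChoice_eq_iff π S t).symm rfl rfl

omit [DecidableEq X] in
theorem topChoice_trans (π : X ≃ Fin (Fintype.card X)) (σ : Equiv.Perm X) :
    topChoice (toLinearOrder (σ.symm.trans π)) = (topChoice (toLinearOrder π)).perm σ := by
  refine Subtype.ext (ChoiceFunction.ext (funext fun S => ?_))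
  rw [topChoice_eq_iff]
  have h := (topChoice_eq_iff π (S.perm σ.symm) _).1 rfl
  refine ⟨((topChoice (toLinearOrder π)).perm σ).1.choice_mem S, fun x hx => ?_⟩
  change π (σ.symm x) ≤ π (σ.symm (σ ((topChoice (toLinearOrder π)).1.choice (S.perm σ.symm))))
  rw [Equiv.symm_apply_apply]
  exact h.2 _ (Finset.mem_map_of_mem σ.symm.toEmbedding hx)

/-- The alternative that society chooses from `S` when the individuals have the rankings `x`. -/
noncomputable def outcome (F : SocialChoiceFunction n X) (S : NonemptySubset X)
    (x : Fin n → (X ≃ Fin (Fintype.card X))) : X :=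
  (F fun i => topChoice (toLinearOrder (x i))).choice S

/-- The indicator of the event that society chooses `t` from `S`. -/
noncomputable def outcomeInd (F : SocialChoiceFunction n X) (S : NonemptySubset X) (t : X)
    (x : Fin n → (X ≃ Fin (Fintype.card X))) : ℝ :=
  if outcome F S x = t then 1 else 0

omit [Fintype X] in
theorem perm_swap_eq {S : NonemptySubset X} {s t : X} (hs : s ∈ S.1) (ht : t ∈ S.1) :
    S.perm (Equiv.swap s t).symm = S := by
  refine Subtype.ext (Finset.ext fun x => ?_)
  change x ∈ S.1.map _ ↔ x ∈ S.1
  rw [Equiv.symm_swap, Finset.mem_map_equiv, Equiv.symm_swap, swap_mem hs ht]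

theorem outcome_swap {F : SocialChoiceFunction n X} (hF : F.Neutral) {S : NonemptySubset X}
    {s t : X} (hs : s ∈ S.1) (ht : t ∈ S.1) (x : Fin n → (X ≃ Fin (Fintype.card X))) :
    outcome F S (fun i => (Equiv.swap s t).symm.trans (x i)) =
      Equiv.swap s t (outcome F S x) := by
  unfold outcome
  simp only [topChoice_trans]
  rw [hF]
  change Equiv.swap s t (ChoiceFunction.choice _ (S.perm (Equiv.swap s t).symm)) = _
  rw [perm_swap_eq hs ht]

/-- By neutrality, under uniform rankings all alternatives of `S` are equally likely outcomes. -/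
theorem expect_uniform_outcomeInd {F : SocialChoiceFunction n X} (hF : F.Neutral)
    {S : NonemptySubset X} {s : X} (hs : s ∈ S.1) :
    expect uniformWeight (outcomeInd F S s) = 1 / (S.1.card : ℝ) := by
  have heq : ∀ t ∈ S.1,
      expect uniformWeight (outcomeInd F S t) = expect uniformWeight (outcomeInd F S s) := by
    intro t ht
    refine Fintype.sum_equiv (Equiv.arrowCongr (Equiv.refl _)
      (Equiv.equivCongr (Equiv.swap s t) (Equiv.refl _))) _ _ fun x => ?_
    have h : (Equiv.arrowCongr (Equiv.refl _)
        (Equiv.equivCongr (Equiv.swap s t) (Equiv.refl _))) x =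
        fun i => (Equiv.swap s t).symm.trans (x i) := by
      ext i y
      simp
    rw [h]
    have h2 : outcomeInd F S s (fun i => (Equiv.swap s t).symm.trans (x i)) =
        outcomeInd F S t x := by
      unfold outcomeInd
      rw [outcome_swap hF hs ht]
      refine if_congr ?_ rfl rfl
      rw [← Equiv.eq_symm_apply, Equiv.symm_swap, Equiv.swap_apply_left]
    rw [h2]
    rfl
  have hsum : ∑ t ∈ S.1, expect uniformWeight (outcomeInd F S t) = 1 := by
    rw [← map_sum, ← expect_const (ι := Fin n) (sum_uniformWeight (X := X)) 1]
    congr 1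
    ext x
    rw [Finset.sum_apply]
    simp only [outcomeInd]
    rw [Finset.sum_ite_eq, if_pos]
    exact ChoiceFunction.choice_mem _ S
  rw [Finset.sum_congr rfl heq, Finset.sum_const, nsmul_eq_mul] at hsum
  rw [eq_div_iff (Nat.cast_ne_zero.2 S.2.card_pos.ne'), mul_comm, hsum]

omit [DecidableEq X] in
theorem outcome_update_congr {F : SocialChoiceFunction n X} (hF : F.IndependentOfRejected)
    {S : NonemptySubset X} (x : Fin n → (X ≃ Fin (Fintype.card X))) (i : Fin n)
    {a b : X ≃ Fin (Fintype.card X)}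
    (h : (topChoice (toLinearOrder a)).1.choice S = (topChoice (toLinearOrder b)).1.choice S) :
    outcome F S (Function.update x i a) = outcome F S (Function.update x i b) := by
  refine hF S _ _ fun j => ?_
  rcases eq_or_ne j i with rfl | hj
  · simpa using h
  · simp only [Function.update_of_ne hj]

theorem outcomeInd_update_le {F : SocialChoiceFunction n X} (hF : F.IndependentOfRejected)
    (hM : F.Monotonic) {S : NonemptySubset X} {s : X}
    (x : Fin n → (X ≃ Fin (Fintype.card X))) (i : Fin n) {a : X ≃ Fin (Fintype.card X)}
    (ha : (topChoice (toLinearOrder a)).1.choice S = s) (b : X ≃ Fin (Fintype.card X)) :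
    outcomeInd F S s (Function.update x i b) ≤ outcomeInd F S s (Function.update x i a) := by
  by_cases hb : outcome F S (Function.update x i b) = s
  · have : outcome F S (Function.update x i a) = s := by
      by_cases hbs : (topChoice (toLinearOrder b)).1.choice S = s
      · rw [outcome_update_congr hF x i (ha.trans hbs.symm), hb]
      · refine (hM S _ _ i ?_ ?_ fun j hj => ?_).trans hb
        · rw [Function.update_self]
          exact fun h => hbs (h.trans hb)
        · rw [Function.update_self]
          exact ha.trans hb.symm
        · rw [Function.update_of_ne hj, Function.update_of_ne hj]
    rw [outcomeInd, outcomeInd, if_pos hb, if_pos this]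
  · rw [outcomeInd, if_neg hb, outcomeInd]
    split_ifs <;> norm_num

theorem exists_topChoice_eq {S : NonemptySubset X} {t : X} (ht : t ∈ S.1) :
    ∃ π : X ≃ Fin (Fintype.card X), (topChoice (toLinearOrder π)).1.choice S = t := by
  let π₀ := Fintype.equivFin X
  have h := (topChoice_eq_iff π₀ S _).1 rfl
  set s := (topChoice (toLinearOrder π₀)).1.choice S
  refine ⟨(Equiv.swap s t).trans π₀, (topChoice_eq_iff _ S t).2 ⟨ht, fun x hx => ?_⟩⟩
  simpa using h.2 _ ((swap_mem h.1 ht x).2 hx)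

/-- Monotonicity lets the tilt towards `c₀` dominate all influences on the event that society
agrees with `c₀` on `S`. -/
theorem abs_sub_avg_outcomeInd_le {F : SocialChoiceFunction n X} (hF : F.IndependentOfRejected)
    (hM : F.Monotonic) (c₀ : ChoiceFunction X) (S : NonemptySubset X)
    {w : (X ≃ Fin (Fintype.card X)) → ℝ} (hw : ∀ π, 0 ≤ w π) (hs : ∑ π, w π = 1) (i : Fin n)
    (x : Fin n → (X ≃ Fin (Fintype.card X))) :
    |outcomeInd F S (c₀.choice S) x - avg w i (outcomeInd F S (c₀.choice S)) x| ≤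
      S.1.card * ∑ π, tilt c₀ π * outcomeInd F S (c₀.choice S) (Function.update x i π) := by
  set s := c₀.choice S with hs_def
  have hsS : s ∈ S.1 := c₀.choice_mem S
  have hcard : (S.1.card : ℝ) ≠ 0 := Nat.cast_ne_zero.2 S.2.card_pos.ne'
  have : Nonempty (X ≃ Fin (Fintype.card X)) := ⟨Fintype.equivFin X⟩
  choose! r hr using fun (t : X) (ht : t ∈ S.1) => exists_topChoice_eq ht
  -- As a function of the ranking of individual `i`, the event depends on the top choice only.
  set g : X → ℝ := fun t => outcomeInd F S s (Function.update x i (r t)) with hg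
  have hcg : ∀ π, outcomeInd F S s (Function.update x i π) =
      g ((topChoice (toLinearOrder π)).1.choice S) := fun π => by
    have hmem := (topChoice (toLinearOrder π)).1.choice_mem S
    simp only [hg, outcomeInd, outcome_update_congr hF x i (hr _ hmem)]
  have hmax : ∀ π, outcomeInd F S s (Function.update x i π) ≤ g s := fun π =>
    outcomeInd_update_le hF hM x i (hr s hsS) π
  obtain ⟨t₀, ht₀, hmin⟩ := S.1.exists_min_image g S.2
  have hmin' : ∀ π, g t₀ ≤ outcomeInd F S s (Function.update x i π) := fun π => by
    rw [hcg]
    exact hmin _ ((topChoice (toLinearOrder π)).1.choice_mem S)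
  have hsum : ∑ π, tilt c₀ π * outcomeInd F S s (Function.update x i π) =
      g s - (∑ t ∈ S.1, g t) / S.1.card := by
    have h1 : ∀ π, tilt c₀ π * outcomeInd F S s (Function.update x i π) =
        ∑ t ∈ S.1, tilt c₀ π * topInd S.1 t π * g t := fun π => by
      simp only [hcg, topInd_eq, mul_ite, mul_one, mul_zero, ite_mul, zero_mul]
      rw [Finset.sum_ite_eq, if_pos ((topChoice (toLinearOrder π)).1.choice_mem S)]
    simp only [h1]
    rw [Finset.sum_comm]
    have h2 : ∀ t ∈ S.1, ∑ π, tilt c₀ π * topInd S.1 t π * g t =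
        (if s = t then g t else 0) - g t / S.1.card := fun t ht => by
      rw [← Finset.sum_mul, sum_tilt_mul_topInd c₀ S ht, ← hs_def]
      split_ifs <;> ring
    rw [Finset.sum_congr rfl h2, Finset.sum_sub_distrib, Finset.sum_ite_eq, if_pos hsS,
      ← Finset.sum_div]
  have hgap : g s - g t₀ ≤ S.1.card * (g s - (∑ t ∈ S.1, g t) / S.1.card) := by
    have h1 : S.1.card * (g s - (∑ t ∈ S.1, g t) / S.1.card) = ∑ t ∈ S.1, (g s - g t) := by
      rw [mul_sub, mul_div_cancel₀ _ hcard, Finset.sum_sub_distrib, Finset.sum_const,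
        nsmul_eq_mul]
    rw [h1]
    exact Finset.single_le_sum (f := fun t => g s - g t)
      (fun t ht => by
        have := hmax (r t)
        exact sub_nonneg.2 this) ht₀
  rw [hsum]
  refine le_trans ?_ hgap
  have hx1 := hmax (x i)
  have hx2 := hmin' (x i)
  rw [Function.update_eq_self] at hx1 hx2
  have ha1 : avg w i (outcomeInd F S s) x ≤ g s := by
    calc avg w i (outcomeInd F S s) x ≤ ∑ π, w π * g s :=
          Finset.sum_le_sum fun π _ => mul_le_mul_of_nonneg_left (hmax π) (hw π)
      _ = g s := by rw [← Finset.sum_mul, hs, one_mul]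
  have ha2 : g t₀ ≤ avg w i (outcomeInd F S s) x := by
    calc g t₀ = ∑ π, w π * g t₀ := by rw [← Finset.sum_mul, hs, one_mul]
      _ ≤ _ := Finset.sum_le_sum fun π _ => mul_le_mul_of_nonneg_left (hmin' π) (hw π)
  rw [abs_le]
  constructor <;> linarith

/-- For a single set `S`, a large society agrees with `c₀` on `S` with high probability. -/
theorem exists_le_expect_outcomeInd {δ : ℝ} (hδ : δ < 1) (m : ℕ) :
    ∃ N : ℕ, ∀ n, N < n → ∀ (X : Type*) [Fintype X] [DecidableEq X], Fintype.card X = m →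
      ∀ (c₀ : ChoiceFunction X) (F : SocialChoiceFunction n X), F.IndependentOfRejected →
        F.Neutral → F.WeaklyAnonymous → F.Monotonic → ∀ S : NonemptySubset X,
          δ ≤ expect (tiltedWeight c₀) (outcomeInd F S (c₀.choice S)) := by
  obtain ⟨N, hN⟩ := exists_sharp_threshold (minWeight_pos m)
    (R := (m + 1) / tiltScale m) (div_pos (by positivity) (tiltScale_pos m))
    (p := 1 / (m + 1)) (by positivity) hδ
  refine ⟨N, fun n hn X _ _ hX c₀ F hI hNeu hA hM S => ?_⟩
  subst hX
  have hε := tiltScale_pos (Fintype.card X)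
  have hS : (S.1.card : ℝ) ≤ Fintype.card X + 1 := by
    have : (S.1.card : ℝ) ≤ Fintype.card X := Nat.cast_le.2 S.1.card_le_univ
    linarith
  refine hN n hn (X ≃ Fin (Fintype.card X)) uniformWeight
    (fun π => tiltScale (Fintype.card X) * tilt c₀ π) sum_uniformWeight (sum_scaled_tilt c₀)
    (fun θ hθ π => minWeight_le c₀ hθ π) _ (fun x => ?_) ?_ (fun θ hθ i x => ?_) ?_
  · unfold outcomeInd
    split_ifs <;> simp
  · obtain ⟨G, hG, hFG⟩ := hA
    refine ⟨G, hG, fun g hg x => ?_⟩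
    unfold outcomeInd outcome
    rw [hFG g hg fun i => topChoice (toLinearOrder (x i))]
  · have hD := abs_sub_avg_outcomeInd_le hI hM c₀ S
      (w := fun π => uniformWeight π + θ * (tiltScale (Fintype.card X) * tilt c₀ π))
      (fun π => (minWeight_pos _).le.trans (minWeight_le c₀ hθ π))
      (by rw [Finset.sum_add_distrib, ← Finset.mul_sum, sum_uniformWeight, sum_scaled_tilt,
        mul_zero, add_zero]) i x
    have hnn : 0 ≤ ∑ π, tilt c₀ π * outcomeInd F S (c₀.choice S) (Function.update x i π) :=
      nonneg_of_mul_nonneg_right ((abs_nonneg _).trans hD) (Nat.cast_pos.2 S.2.card_pos)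
    refine hD.trans ((mul_le_mul_of_nonneg_right hS hnn).trans_eq ?_)
    simp only [mul_assoc]
    rw [← Finset.mul_sum]
    field_simp
  · rw [expect_uniform_outcomeInd hNeu (c₀.choice_mem S)]
    exact one_div_le_one_div_of_le (Nat.cast_pos.2 S.2.card_pos) hS

end Social

end PermOrder

/-! ### Agreement on all sets simultaneously -/

open FiniteProduct PermOrder

theorem mainTheorem5 :
    ∃ N : ℝ → ℕ → ℕ, ∀ (X : Type*) [Fintype X] (c₀ : ChoiceFunction X),
      ∃ ν : PMF (LinearOrder X), ∀ δ : ℝ, δ < 1 → ∀ n : ℕ, N δ (Fintype.card X) < n →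
        ∀ F : SocialChoiceFunction n X,
          F.IndependentOfRejected → F.Pareto → F.Neutral → F.WeaklyAnonymous → F.Monotonic →
            δ ≤ (iidOrderings ν n).real
              {L | ∀ S : NonemptySubset X, (F fun i => topChoice (L i)).choice S = c₀.choice S} :=
  by
  classical
  -- The failure probability `1 - δ` is shared among the at most `2 ^ m` sets of alternatives.
  have hlt : ∀ δ : ℝ, δ < 1 → ∀ m : ℕ, 1 - (1 - δ) / 2 ^ m < 1 := fun δ hδ m =>
    sub_lt_self _ (div_pos (by linarith) (by positivity))
  choose! N hN using fun (δ : ℝ) (hδ : δ < 1) (m : ℕ) => exists_le_expect_outcomeInd (hlt δ hδ m) m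
  refine ⟨N, fun X _ c₀ => ⟨tiltedLaw c₀, fun δ hδ n hn F hI _ hNeu hA hM => ?_⟩⟩
  refine le_trans ?_ (expect_le_iidOrderings c₀ n _)
  have hS := hN δ hδ _ n hn X rfl c₀ F hI hNeu hA hM
  have hw := tiltedWeight_pos c₀
  have hs := sum_tiltedWeight c₀
  have hunion : expect (tiltedWeight c₀) ((fun _ => 1) -
      ∑ S : NonemptySubset X, ((fun _ => 1) - outcomeInd F S (c₀.choice S))) ≤
      expect (tiltedWeight c₀) (fun x => if (fun i => toLinearOrder (x i)) ∈
        {L | ∀ S : NonemptySubset X, (F fun i => topChoice (L i)).choice S = c₀.choice S}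
          then 1 else 0) := by
    refine expect_mono hw fun x => ?_
    have hnn : ∀ S : NonemptySubset X, 0 ≤ 1 - outcomeInd F S (c₀.choice S) x := fun S => by
      unfold outcomeInd
      split_ifs <;> norm_num
    simp only [Pi.sub_apply, Finset.sum_apply]
    split_ifs with h
    · linarith [Finset.sum_nonneg fun S (_ : S ∈ Finset.univ) => hnn S]
    · rw [Set.mem_ofPred_eq, not_forall] at h
      obtain ⟨S, hSne⟩ := h
      have h1 := Finset.single_le_sum (fun S _ => hnn S) (Finset.mem_univ S)
      have h2 : outcomeInd F S (c₀.choice S) x = 0 := if_neg hSne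
      linarith
  refine le_trans ?_ hunion
  rw [map_sub, map_sum, expect_const hs]
  have hsum : ∑ S : NonemptySubset X,
      expect (tiltedWeight c₀) ((fun _ => 1) - outcomeInd F S (c₀.choice S)) ≤ 1 - δ := by
    calc ∑ S : NonemptySubset X,
          expect (tiltedWeight c₀) ((fun _ => 1) - outcomeInd F S (c₀.choice S))
        ≤ ∑ S : NonemptySubset X, (1 - δ) / 2 ^ Fintype.card X :=
          Finset.sum_le_sum fun S _ => by
            rw [map_sub, expect_const hs]
            linarith [hS S]
      _ = Fintype.card (NonemptySubset X) * ((1 - δ) / 2 ^ Fintype.card X) := by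
          rw [Finset.sum_const, nsmul_eq_mul, Finset.card_univ]
      _ ≤ 2 ^ Fintype.card X * ((1 - δ) / 2 ^ Fintype.card X) := by
          refine mul_le_mul_of_nonneg_right ?_ (div_nonneg (by linarith) (by positivity))
          have h : Fintype.card (NonemptySubset X) ≤ 2 ^ Fintype.card X :=
            (Fintype.card_subtype_le _).trans_eq Fintype.card_finset
          exact_mod_cast h
      _ = 1 - δ := by field_simp
  linarith
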